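/- Let $J=(0,1)$, let $b_0:J\to\mathbb R$ and $b_1:J\to\mathbb C$ be measurable with $b_0<0$ a.e. on $J$, and assume that $w:=-1/b_0$ and $b_1/b_0$ belong to $L^1(J,\mathbb C)$. Let $\nu_0,\nu_1$ be Borel probability measures on $J$. In the space $L^2_w(J,\mathbb C)$ with weight $w$ let $L$ be the operator $Ly=b_0y''+b_1y'$ whose domain consists of all $y\in L^2_w(J,\mathbb C)$ such that $y,y'\in AC[0,1]$, $b_0y''+b_1y'\in L^2_w(J,\mathbb C)$, $y(0)=\int_0^1 y\,d\nu_0$ and $y(1)=\int_0^1 y\,d\nu_1$. Let $L_0$ be the Dirichlet operator, given by the same expression with the boundary conditions replaced by $y(0)=y(1)=0$. For an operator $T$ write $\rho(T)$, $\sigma(T)$, $\sigma_p(T)$ for its resolvent set, spectrum and set of eigenvalues, and $R_\lambda(T)=(T-\lambda I)^{-1}$ for $\lambda\in\rho(T)$. Then: 1. $L$ is closed, and its spectrum is purely discrete: every point of $\sigma(L)$ is an isolated point of $\sigma(L)$ and an eigenvalue of finite algebraic multiplicity. 2. $R_\lambda(L)$ is a compact operator for every $\lambda\in\rho(L)$.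 3. Let $\lambda\in\rho(L_0)\setminus\sigma_p(L)$. Then $\lambda\in\rho(L)$. The equation $b_0y''+b_1y'=\lambda y$ has fundamental solutions $y_1,y_2$ with $y_1(0)=y_2'(0)=1$, $y_1'(0)=y_2(0)=0$, the number $$\Delta=\det\begin{pmatrix}\int_0^1 y_1\,d\nu_0-1&\int_0^1 y_2\,d\nu_0\\ \int_0^1 y_1\,d\nu_1-y_1(1)&\int_0^1 y_2\,d\nu_1-y_2(1)\end{pmatrix}$$ is nonzero, and for all $f\in L^2_w(J,\mathbb C)$ and $x\in[0,1]$, with the continuous representatives of $R_\lambda(L)f$ and $R_\lambda(L_0)f$, $$(R_\lambda(L)f)(x)=(R_\lambda(L_0)f)(x)+g_0(x)\int_0^1 R_\lambda(L_0)f\,d\nu_0+g_1(x)\int_0^1 R_\lambda(L_0)f\,d\nu_1,$$ where $$g_0=\frac{\left[y_2(1)-\int_0^1 y_2\,d\nu_1\right]y_1-\left[y_1(1)-\int_0^1 y_1\,d\nu_1\right]y_2}{\Delta},\qquad g_1=\frac{\left[1-\int_0^1 y_1\,d\nu_0\right]y_2+\left[\int_0^1 y_2\,d\nu_0\right]y_1}{\Delta}.$$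 4. For every $\lambda_0\in\sigma(L)$, $\lambda_0$ is a pole of finite order of $\lambda\mapsto R_\lambda(L)$, and the ascent of $L-\lambda_0I$, that is, the smallest integer $p>0$ with $\ker((L-\lambda_0I)^p)=\ker((L-\lambda_0I)^{p+1})$, is finite. -/

import Mathlib

open MeasureTheory Set Filter Topology

noncomputable section

/-! ### Unbounded operators in a complex Banach space -/

namespace UnboundedOp

variable {H : Type*} [NormedAddCommGroup H] [NormedSpace ℂ H]

/-- The operator `T - c I`, with the same domain as `T`. -/
def shift (T : H →ₗ.[ℂ] H) (c : ℂ) : H →ₗ.[ℂ] H where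
  domain := T.domain
  toFun := T.toFun - c • T.domain.subtype

/-- `R` is a bounded everywhere defined two-sided inverse of `T - z I`. -/
def IsResolventAt (T : H →ₗ.[ℂ] H) (z : ℂ) (R : H →L[ℂ] H) : Prop :=
  (∀ f : H, ∃ h : R f ∈ (shift T z).domain, shift T z ⟨R f, h⟩ = f) ∧
    ∀ x : (shift T z).domain, R (shift T z x) = x

/-- The resolvent set `ρ(T)`. -/
def resolventSet (T : H →ₗ.[ℂ] H) : Set ℂ := {z | ∃ R : H →L[ℂ] H, IsResolventAt T z R}

/-- The spectrum `σ(T)`. -/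
def spectrum (T : H →ₗ.[ℂ] H) : Set ℂ := (resolventSet T)ᶜ

open Classical in
/-- The resolvent `(T - z I)⁻¹` for `z ∈ ρ(T)` (and `0` for other `z`). -/
def resolvent (T : H →ₗ.[ℂ] H) (z : ℂ) : H →L[ℂ] H :=
  if h : ∃ R : H →L[ℂ] H, IsResolventAt T z R then h.choose else 0

/-- The kernel of the power `T ^ n`, where `T ^ (n + 1)` has the domain
`{x ∈ dom T | T x ∈ dom (T ^ n)}`. -/
def kerPow (T : H →ₗ.[ℂ] H) : ℕ → Submodule ℂ H
  | 0 => ⊥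
  | n + 1 => ((kerPow T n).comap T.toFun).map T.domain.subtype

/-- The point spectrum `σₚ(T)`: the set of eigenvalues. -/
def pointSpectrum (T : H →ₗ.[ℂ] H) : Set ℂ := {z | kerPow (shift T z) 1 ≠ ⊥}

/-- The generalized eigenspace `⋃ₙ ker ((T - z I) ^ n)`. -/
def genEigenspace (T : H →ₗ.[ℂ] H) (z : ℂ) : Submodule ℂ H := ⨆ n, kerPow (shift T z) n

/-- The ascent: the smallest `p > 0` with `ker (T ^ p) = ker (T ^ (p + 1))`, and `⊤` if there
is none. -/
def ascent (T : H →ₗ.[ℂ] H) : ℕ∞ :=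
  ⨅ p ∈ {p : ℕ | 0 < p ∧ kerPow T p = kerPow T (p + 1)}, (p : ℕ∞)

/-- The spectrum is purely discrete: each of its points is isolated and is an eigenvalue of finite
algebraic multiplicity. -/
def HasPurelyDiscreteSpectrum (T : H →ₗ.[ℂ] H) : Prop :=
  ∀ z ∈ spectrum T, (∀ᶠ z' in 𝓝[≠] z, z' ∈ resolventSet T) ∧ z ∈ pointSpectrum T ∧
    FiniteDimensional ℂ (genEigenspace T z)

/-- The resolvent has a pole (of finite order) at `z`. -/
def IsResolventPole (T : H →ₗ.[ℂ] H) (z : ℂ) : Prop :=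
  (∀ᶠ z' in 𝓝[≠] z, z' ∈ resolventSet T) ∧
    MeromorphicAt (resolvent T) z ∧ meromorphicOrderAt (resolvent T) z < 0

end UnboundedOp

/-! ### The diffusion operator with jumping boundary -/

namespace JumpDiffusion

/-- The measure `w(x) dx` on `J = (0, 1)` with the weight `w = -1 / b₀`. -/
def wMeasure (b₀ : ℝ → ℝ) : Measure ℝ :=
  (volume.restrict (Ioo 0 1)).withDensity fun x => ENNReal.ofReal (-1 / b₀ x)

/-- The space `L²_w(J, ℂ)`. -/
abbrev L2w (b₀ : ℝ → ℝ) : Type := Lp ℂ 2 (wMeasure b₀)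

/-- `y` is differentiable on `[0, 1]` with derivative `y'`, and `y, y' ∈ AC[0, 1]`. -/
structure HasACDeriv (y y' : ℝ → ℂ) : Prop where
  ac : AbsolutelyContinuousOnInterval y 0 1
  ac' : AbsolutelyContinuousOnInterval y' 0 1
  hasDeriv : ∀ x ∈ Icc (0 : ℝ) 1, HasDerivWithinAt y (y' x) (Icc 0 1) x

/-- The differential expression `b₀ y'' + b₁ y'`, as a function of the derivative `y'`. -/
def diffExpr (b₀ : ℝ → ℝ) (b₁ : ℝ → ℂ) (y' : ℝ → ℂ) (x : ℝ) : ℂ :=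
  (b₀ x : ℂ) * deriv y' x + b₁ x * y' x

lemma HasACDeriv.add {y y' u u' : ℝ → ℂ} (h : HasACDeriv y y') (k : HasACDeriv u u') :
    HasACDeriv (y + u) (y' + u') :=
  ⟨h.ac.add k.ac, h.ac'.add k.ac', fun x hx => (h.hasDeriv x hx).add (k.hasDeriv x hx)⟩

lemma HasACDeriv.smul {y y' : ℝ → ℂ} (c : ℂ) (h : HasACDeriv y y') :
    HasACDeriv (c • y) (c • y') :=
  ⟨h.ac.const_smul c, h.ac'.const_smul c, fun x hx => (h.hasDeriv x hx).const_smul c⟩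

lemma HasACDeriv.zero : HasACDeriv 0 0 := by
  have h0 : AbsolutelyContinuousOnInterval (0 : ℝ → ℂ) 0 1 := by
    have : LipschitzOnWith 0 (0 : ℝ → ℂ) (uIcc 0 1) := fun x _ y _ => by simp
    exact this.absolutelyContinuousOnInterval
  exact ⟨h0, h0, fun x _ => hasDerivWithinAt_const x (Icc (0 : ℝ) 1) (0 : ℂ)⟩

lemma HasACDeriv.ae_differentiableAt {y y' : ℝ → ℂ} (b₀ : ℝ → ℝ) (h : HasACDeriv y y') :
    ∀ᵐ x ∂wMeasure b₀, DifferentiableAt ℝ y' x := by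
  have hv : LocallyBoundedVariationOn y' (Icc 0 1) := by
    have := h.ac'.boundedVariationOn
    rw [uIcc_of_le zero_le_one] at this
    exact this.locallyBoundedVariationOn
  have h1 := hv.ae_differentiableWithinAt_of_mem
  have h2 : ∀ᵐ x ∂volume.restrict (Ioo (0 : ℝ) 1), DifferentiableAt ℝ y' x := by
    rw [ae_restrict_iff' measurableSet_Ioo]
    filter_upwards [h1] with x hx hx'
    exact (hx (Ioo_subset_Icc_self hx')).differentiableAt (Icc_mem_nhds hx'.1 hx'.2)
  exact (withDensity_absolutelyContinuous _ _).ae_le h2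

lemma HasACDeriv.integrable {y y' : ℝ → ℂ} (h : HasACDeriv y y') (ν : Measure (Ioo (0 : ℝ) 1))
    [IsFiniteMeasure ν] : Integrable (fun x : Ioo (0 : ℝ) 1 => y x) ν := by
  have hc : ContinuousOn y (Icc 0 1) := by
    simpa [uIcc_of_le zero_le_one] using h.ac.continuousOn
  obtain ⟨C, hC⟩ := isCompact_Icc.exists_bound_of_continuousOn hc
  have hm : Continuous fun x : Ioo (0 : ℝ) 1 => y x :=
    continuousOn_iff_continuous_domRestrict.1 (hc.mono Ioo_subset_Icc_self)
  exact Integrable.of_bound hm.aestronglyMeasurable C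
    (Eventually.of_forall fun x => hC x (Ioo_subset_Icc_self x.2))

/-- The graph of the operator `L`: the pairs `(y, Ly)` such that `y, y' ∈ AC[0, 1]`, both
`y` and `Ly = b₀ y'' + b₁ y'` belong to `L²_w(J, ℂ)`, `y(0) = ∫ y dν₀` and `y(1) = ∫ y dν₁`. -/
def jumpGraph (b₀ : ℝ → ℝ) (b₁ : ℝ → ℂ) (ν₀ ν₁ : Measure (Ioo (0 : ℝ) 1))
    [IsFiniteMeasure ν₀] [IsFiniteMeasure ν₁] : Submodule ℂ (L2w b₀ × L2w b₀) where
  carrier := {p | ∃ y y' : ℝ → ℂ, HasACDeriv y y' ∧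
    p.1 =ᵐ[wMeasure b₀] y ∧ p.2 =ᵐ[wMeasure b₀] diffExpr b₀ b₁ y' ∧
    y 0 = ∫ x, y x ∂ν₀ ∧ y 1 = ∫ x, y x ∂ν₁}
  add_mem' := by
    rintro p q ⟨y, y', h, h1, h2, h3, h4⟩ ⟨u, u', k, k1, k2, k3, k4⟩
    refine ⟨y + u, y' + u', h.add k, ?_, ?_, ?_, ?_⟩
    · filter_upwards [Lp.coeFn_add p.1 q.1, h1, k1] with x a b c
      simp only [Prod.fst_add, a, Pi.add_apply, b, c]
    · filter_upwards [Lp.coeFn_add p.2 q.2, h2, k2, h.ae_differentiableAt b₀,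
        k.ae_differentiableAt b₀] with x a b c d e
      simp only [Prod.snd_add, a, Pi.add_apply, b, c, diffExpr, deriv_add d e]
      ring
    · simp only [Pi.add_apply]
      rw [integral_add (h.integrable ν₀) (k.integrable ν₀), h3, k3]
    · simp only [Pi.add_apply]
      rw [integral_add (h.integrable ν₁) (k.integrable ν₁), h4, k4]
  zero_mem' := by
    refine ⟨0, 0, HasACDeriv.zero, Lp.coeFn_zero _ _ _, ?_, by simp, by simp⟩
    filter_upwards [Lp.coeFn_zero ℂ 2 (wMeasure b₀)] with x hx
    rw [Prod.snd_zero, hx]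
    simp [diffExpr]
  smul_mem' := by
    rintro c p ⟨y, y', h, h1, h2, h3, h4⟩
    refine ⟨c • y, c • y', h.smul c, ?_, ?_, ?_, ?_⟩
    · filter_upwards [Lp.coeFn_smul c p.1, h1] with x a b
      simp [a, b]
    · filter_upwards [Lp.coeFn_smul c p.2, h2, h.ae_differentiableAt b₀] with x a b d
      simp only [Prod.smul_snd, a, Pi.smul_apply, b, diffExpr, deriv_const_smul c d, smul_eq_mul]
      ring
    · simp only [Pi.smul_apply, integral_smul, h3]
    · simp only [Pi.smul_apply, integral_smul, h4]

/-- The operator `L` in `L²_w(J, ℂ)` with the boundary conditions `y(0) = ∫ y dν₀` and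
`y(1) = ∫ y dν₁`. -/
def jumpOperator (b₀ : ℝ → ℝ) (b₁ : ℝ → ℂ) (ν₀ ν₁ : Measure (Ioo (0 : ℝ) 1))
    [IsFiniteMeasure ν₀] [IsFiniteMeasure ν₁] : L2w b₀ →ₗ.[ℂ] L2w b₀ :=
  (jumpGraph b₀ b₁ ν₀ ν₁).toLinearPMap

/-- The Dirichlet operator `L₀`, with boundary conditions `y(0) = y(1) = 0`: these are the above
boundary conditions for zero measures. -/
def dirichletOperator (b₀ : ℝ → ℝ) (b₁ : ℝ → ℂ) : L2w b₀ →ₗ.[ℂ] L2w b₀ :=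
  jumpOperator b₀ b₁ 0 0

/-- A property that holds almost everywhere for `w(x) dx` holds almost everywhere on `(0, 1)`. -/
lemma ae_of_ae_wMeasure {b₀ : ℝ → ℝ} (hneg : ∀ᵐ x ∂volume.restrict (Ioo (0 : ℝ) 1), b₀ x < 0)
    (hw : IntegrableOn (fun x => -1 / b₀ x) (Ioo 0 1)) {p : ℝ → Prop}
    (hp : ∀ᵐ x ∂wMeasure b₀, p x) : ∀ᵐ x ∂volume.restrict (Ioo (0 : ℝ) 1), p x := by
  rw [wMeasure, ae_withDensity_iff' hw.aestronglyMeasurable.aemeasurable.ennreal_ofReal] at hp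
  filter_upwards [hp, hneg] with x hx hn
  exact hx (by simpa using div_pos_of_neg_of_neg (by norm_num) hn)

/-- The operator is well defined: its graph is the set of pairs used to define it. -/
lemma graph_jumpOperator {b₀ : ℝ → ℝ} (b₁ : ℝ → ℂ)
    (hneg : ∀ᵐ x ∂volume.restrict (Ioo (0 : ℝ) 1), b₀ x < 0)
    (hw : IntegrableOn (fun x => -1 / b₀ x) (Ioo 0 1)) (ν₀ ν₁ : Measure (Ioo (0 : ℝ) 1))
    [IsFiniteMeasure ν₀] [IsFiniteMeasure ν₁] :
    (jumpOperator b₀ b₁ ν₀ ν₁).graph = jumpGraph b₀ b₁ ν₀ ν₁ := by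
  refine Submodule.toLinearPMap_graph_eq _ ?_
  rintro ⟨f, g⟩ ⟨y, y', h, h1, h2, -, -⟩ hf
  simp only at hf h1 h2 ⊢
  subst hf
  have hy : y =ᵐ[volume.restrict (Ioo (0 : ℝ) 1)] (fun _ => (0 : ℂ)) := by
    refine ae_of_ae_wMeasure hneg hw ?_
    filter_upwards [h1, Lp.coeFn_zero ℂ 2 (wMeasure b₀)] with x a b
    rw [← a, b]
    rfl
  have hc : ContinuousOn y (Ioo 0 1) := by
    have : ContinuousOn y (Icc 0 1) := by
      simpa [uIcc_of_le zero_le_one] using h.ac.continuousOn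
    exact this.mono Ioo_subset_Icc_self
  have hy0 : EqOn y (fun _ => (0 : ℂ)) (Ioo 0 1) :=
    Measure.eqOn_open_of_ae_eq hy isOpen_Ioo hc continuousOn_const
  have hy'0 : EqOn y' (fun _ => (0 : ℂ)) (Ioo 0 1) := by
    intro x hx
    have hd := (h.hasDeriv x (Ioo_subset_Icc_self hx)).hasDerivAt (Icc_mem_nhds hx.1 hx.2)
    have he : y =ᶠ[𝓝 x] fun _ => (0 : ℂ) := hy0.eventuallyEq_of_mem (isOpen_Ioo.mem_nhds hx)
    exact hd.unique ((hasDerivAt_const x (0 : ℂ)).congr_of_eventuallyEq he)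
  refine (Lp.eq_zero_iff_ae_eq_zero).2 ?_
  have hJ : ∀ᵐ x ∂wMeasure b₀, x ∈ Ioo (0 : ℝ) 1 :=
    (withDensity_absolutelyContinuous _ _).ae_le (ae_restrict_mem measurableSet_Ioo)
  filter_upwards [h2, hJ] with x a hx
  have he : y' =ᶠ[𝓝 x] fun _ => (0 : ℂ) := hy'0.eventuallyEq_of_mem (isOpen_Ioo.mem_nhds hx)
  rw [a, diffExpr, he.deriv_eq, hy'0 hx]
  simp

/-- `y`, with derivative `y'`, is a solution of `b₀ y'' + b₁ y' = z y` on `[0, 1]`. -/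
structure IsSolution (b₀ : ℝ → ℝ) (b₁ : ℝ → ℂ) (z : ℂ) (y y' : ℝ → ℂ) : Prop where
  hasACDeriv : HasACDeriv y y'
  eqn : ∀ᵐ x ∂volume.restrict (Ioo (0 : ℝ) 1), diffExpr b₀ b₁ y' x = z * y x

/-- `y₁, y₂` are the fundamental solutions of `b₀ y'' + b₁ y' = z y` with
`y₁(0) = y₂'(0) = 1` and `y₁'(0) = y₂(0) = 0`. -/
def IsFundamentalPair (b₀ : ℝ → ℝ) (b₁ : ℝ → ℂ) (z : ℂ) (y₁ y₂ : ℝ → ℂ) : Prop :=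
  ∃ y₁' y₂' : ℝ → ℂ, IsSolution b₀ b₁ z y₁ y₁' ∧ IsSolution b₀ b₁ z y₂ y₂' ∧
    y₁ 0 = 1 ∧ y₁' 0 = 0 ∧ y₂ 0 = 0 ∧ y₂' 0 = 1

/-- The characteristic determinant `Δ`, in terms of the fundamental solutions. -/
def charDet (ν₀ ν₁ : Measure (Ioo (0 : ℝ) 1)) (y₁ y₂ : ℝ → ℂ) : ℂ :=
  Matrix.det !![(∫ x, y₁ x ∂ν₀) - 1, ∫ x, y₂ x ∂ν₀;
    (∫ x, y₁ x ∂ν₁) - y₁ 1, (∫ x, y₂ x ∂ν₁) - y₂ 1]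

/-- The function `g₀` of the resolvent formula. -/
def g₀ (ν₀ ν₁ : Measure (Ioo (0 : ℝ) 1)) (y₁ y₂ : ℝ → ℂ) (x : ℝ) : ℂ :=
  ((y₂ 1 - ∫ t, y₂ t ∂ν₁) * y₁ x - (y₁ 1 - ∫ t, y₁ t ∂ν₁) * y₂ x) / charDet ν₀ ν₁ y₁ y₂

/-- The function `g₁` of the resolvent formula. -/
def g₁ (ν₀ ν₁ : Measure (Ioo (0 : ℝ) 1)) (y₁ y₂ : ℝ → ℂ) (x : ℝ) : ℂ :=
  ((1 - ∫ t, y₁ t ∂ν₀) * y₂ x + y₁ x * ∫ t, y₂ t ∂ν₀) / charDet ν₀ ν₁ y₁ y₂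

/-- `u` is a representative of `f ∈ L²_w(J, ℂ)` that is continuous on `[0, 1]`. -/
def IsContRep {b₀ : ℝ → ℝ} (f : L2w b₀) (u : ℝ → ℂ) : Prop :=
  ContinuousOn u (Icc 0 1) ∧ f =ᵐ[wMeasure b₀] u

end JumpDiffusion

end

/-!
The operator is treated through the initial value problem. With the integrating factor
`p = exp ∫ b₁ / b₀`, the equation `b₀ y'' + b₁ y' = g` reads `(p y')' = -p w g`, and two
integrations give `y = y(0) + y'(0) ∫ 1 / p + V g`, where `V` (`volterra`) is a compact Volterra
operator from `L²_w` to the bounded continuous functions. Its iterates decay factorially, so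
`1 - z V`, with `V` composed with the inclusion into `L²_w`, is invertible for every `z`, and its
inverse is an entire function of `z`. In these terms `L` is the restriction of the solutions to
the kernel of the boundary functionals `y ↦ y(0) - ∫ y dν₀` and `y ↦ y(1) - ∫ y dν₁`. This
structure is isolated as `UnboundedOp.IsBoundaryProblem`. It implies that `z` belongs to the
resolvent set exactly if the characteristic function, the determinant of the boundary values of
the two fundamental solutions, does not vanish at `z`; and that the resolvent is then this
function's reciprocal times an entire function, and is the sum of a compact Volterra part and
operators of rank one. If the characteristic function is not identically zero, its zeros are
isolated, the resolvent is meromorphic, and the statements on the spectrum follow: at an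
eigenvector the resolvent is unbounded, and the order of the pole bounds the length of the Jordan
chains. The formula for the resolvent is Cramer's rule.

What needs an argument is that the characteristic function is not identically zero, that is,
`nonempty_resolventSet`. For a real drift one would use the maximum principle at `z = -s`,
`s > 0`. For a complex drift, split `b₁ / b₀ = β + k` with `|β| ≤ C √w` and `k` of small integral,
and consider `Z = exp (∫ k) y' ȳ` for a solution `y`. For large `s` the derivative of `Z` lies in
a narrow cone around the positive axis and is comparable with the energy density
`|y'|² + s w |y|²`, and the exponential is close to one. So if `y` vanishes at one endpoint, then
`Re (y' ȳ) = (|y|²)' / 2` has a fixed sign and dominates the energy between that endpoint and `x`.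
Hence `|y|` is monotone, and with `y` normalized to one at the other endpoint it tends to zero in
`(0, 1)` as `s → ∞`. By dominated convergence the matrix of boundary values of these two solutions
tends to the identity.
-/

noncomputable section

/-! ### Resolvents, generalized eigenspaces and poles -/

namespace UnboundedOp

section Resolvent

variable {H : Type*} [NormedAddCommGroup H] [NormedSpace ℂ H] {T : H →ₗ.[ℂ] H} {z z₀ : ℂ}

lemma mem_graph_shift {x g : H} : (x, g) ∈ (shift T z).graph ↔ (x, g + z • x) ∈ T.graph := by
  simp only [LinearPMap.mem_graph_iff]
  constructor
  · rintro ⟨y, rfl, h⟩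
    refine ⟨y, rfl, ?_⟩
    have h' : T y - z • (y : H) = g := h
    rw [← h']
    simp
  · rintro ⟨y, rfl, h⟩
    refine ⟨y, rfl, ?_⟩
    change T y - z • (y : H) = g
    rw [h]
    simp

lemma mem_kerPow_succ {n : ℕ} {x : H} :
    x ∈ kerPow T (n + 1) ↔ ∃ g, (x, g) ∈ T.graph ∧ g ∈ kerPow T n := by
  constructor
  · rintro ⟨y, hy, rfl⟩
    exact ⟨T y, T.mem_graph y, hy⟩
  · rintro ⟨g, hg, hn⟩
    obtain ⟨y, hy, h⟩ := T.mem_graph_iff.1 hg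
    simp only at hy h
    subst hy h
    exact ⟨y, hn, rfl⟩

lemma kerPow_le_succ (n : ℕ) : kerPow T n ≤ kerPow T (n + 1) := by
  induction n with
  | zero => exact bot_le
  | succ n ih =>
    intro x hx
    obtain ⟨g, hg, hgn⟩ := mem_kerPow_succ.1 hx
    exact mem_kerPow_succ.2 ⟨g, hg, ih hgn⟩

lemma mem_kerPow_one {x : H} : x ∈ kerPow T 1 ↔ (x, 0) ∈ T.graph := by
  rw [mem_kerPow_succ]
  constructor
  · rintro ⟨g, hg, h⟩
    rwa [(Submodule.mem_bot ℂ).1 h] at hg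
  · exact fun h => ⟨0, h, Submodule.zero_mem _⟩

lemma mem_kerPow_succ_shift {n : ℕ} {x : H} :
    x ∈ kerPow (shift T z) (n + 1) ↔
      ∃ g, (x, g + z • x) ∈ T.graph ∧ g ∈ kerPow (shift T z) n := by
  simp only [mem_kerPow_succ, mem_graph_shift]

lemma mem_pointSpectrum : z ∈ pointSpectrum T ↔ ∃ x ≠ 0, (x, z • x) ∈ T.graph := by
  rw [pointSpectrum, mem_ofPred_eq, Submodule.ne_bot_iff]
  simp only [mem_kerPow_one, mem_graph_shift, zero_add]
  exact ⟨fun ⟨x, h, h0⟩ => ⟨x, h0, h⟩, fun ⟨x, h0, h⟩ => ⟨x, h, h0⟩⟩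

/-- The resolvent property in terms of the graph of the operator. -/
lemma isResolventAt_iff {R : H →L[ℂ] H} : IsResolventAt T z R ↔
    (∀ f, (R f, f + z • R f) ∈ T.graph) ∧ ∀ x g, (x, g) ∈ T.graph → R (g - z • x) = x := by
  constructor
  · rintro ⟨h1, h2⟩
    constructor
    · intro f
      obtain ⟨h, hf⟩ := h1 f
      rw [← mem_graph_shift, LinearPMap.mem_graph_iff]
      exact ⟨_, rfl, hf⟩
    · intro x g hx
      have hx' : (x, g - z • x) ∈ (shift T z).graph := by
        rw [mem_graph_shift]; simpa using hx
      obtain ⟨y, rfl, hg⟩ := (LinearPMap.mem_graph_iff _).1 hx'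
      simp only at hg
      rw [← hg]
      exact h2 y
  · rintro ⟨h1, h2⟩
    constructor
    · intro f
      have := h1 f
      rw [← mem_graph_shift, LinearPMap.mem_graph_iff] at this
      obtain ⟨y, hy, hf⟩ := this
      simp only at hy hf
      have hd : R f ∈ (shift T z).domain := hy ▸ y.2
      have hyd : (⟨R f, hd⟩ : (shift T z).domain) = y := Subtype.ext hy.symm
      exact ⟨hd, by rw [hyd, hf]⟩
    · intro x
      have := (shift T z).mem_graph x
      rw [mem_graph_shift] at this
      have h := h2 _ _ this
      simpa using h

lemma IsResolventAt.unique {R R' : H →L[ℂ] H} (h : IsResolventAt T z R)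
    (h' : IsResolventAt T z R') : R = R' := by
  rw [isResolventAt_iff] at h h'
  ext f
  have := h'.2 _ _ (h.1 f)
  simpa using this.symm

lemma isResolventAt_resolvent (h : z ∈ resolventSet T) : IsResolventAt T z (resolvent T z) := by
  have h' : ∃ R : H →L[ℂ] H, IsResolventAt T z R := h
  rw [resolvent, dif_pos h']
  exact h'.choose_spec

lemma IsResolventAt.mem {R : H →L[ℂ] H} (h : IsResolventAt T z R) : z ∈ resolventSet T := ⟨R, h⟩

lemma IsResolventAt.resolvent_eq {R : H →L[ℂ] H} (h : IsResolventAt T z R) :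
    resolvent T z = R := (isResolventAt_resolvent h.mem).unique h

lemma IsResolventAt.apply_eq {R : H →L[ℂ] H} (h : IsResolventAt T z R) {x f : H}
    (hx : (x, f + z • x) ∈ T.graph) : R f = x := by
  simpa using (isResolventAt_iff.1 h).2 _ _ hx

lemma notMem_resolventSet (h : z ∈ pointSpectrum T) : z ∉ resolventSet T := by
  rintro ⟨R, hR⟩
  obtain ⟨x, h0, hx⟩ := mem_pointSpectrum.1 h
  refine h0 ?_
  have := hR.apply_eq (x := x) (f := 0) (by simpa using hx)
  rw [← this, map_zero]

lemma isClosed_of_mem_resolventSet (h : z ∈ resolventSet T) : T.IsClosed := by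
  obtain ⟨R, hR⟩ := h
  rw [isResolventAt_iff] at hR
  have : (T.graph : Set (H × H)) = {p | R (p.2 - z • p.1) = p.1} := by
    ext ⟨x, g⟩
    constructor
    · exact hR.2 x g
    · intro hx
      simp only [mem_ofPred_eq] at hx
      have := hR.1 (g - z • x)
      rw [hx] at this
      simpa using this
  rw [LinearPMap.IsClosed, this]
  exact isClosed_eq (by fun_prop) continuous_fst

/-- At an eigenvector the resolvent is unbounded near the eigenvalue, so it cannot extend
analytically. -/
lemma meromorphicOrderAt_resolvent_neg (hm : MeromorphicAt (resolvent T) z₀)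
    (hev : ∀ᶠ z in 𝓝[≠] z₀, z ∈ resolventSet T) (hz : z₀ ∈ pointSpectrum T) :
    meromorphicOrderAt (resolvent T) z₀ < 0 := by
  by_contra hn
  obtain ⟨c, hc⟩ := (tendsto_nhds_iff_meromorphicOrderAt_nonneg hm).2 (not_lt.1 hn)
  obtain ⟨x, h0, hx⟩ := mem_pointSpectrum.1 hz
  have h1 : Tendsto (fun z => (z₀ - z) • resolvent T z x) (𝓝[≠] z₀) (𝓝 ((z₀ - z₀) • c x)) := by
    refine Tendsto.smul ?_ ?_
    · exact ((continuous_const.sub continuous_id).tendsto z₀).mono_left nhdsWithin_le_nhds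
    · exact ((ContinuousLinearMap.apply ℂ H x).continuous.tendsto c).comp hc
  have h2 : ∀ᶠ z in 𝓝[≠] z₀, (z₀ - z) • resolvent T z x = x := by
    filter_upwards [hev] with z hz
    rw [← map_smul]
    refine (isResolventAt_resolvent hz).apply_eq ?_
    convert hx using 2
    module
  have h3 := h1.congr' h2
  rw [sub_self, zero_smul] at h3
  exact h0 (tendsto_nhds_unique tendsto_const_nhds h3)

/-- If `x` is a generalized eigenvector of rank at most `n + 1` and `(z - z₀) ^ n R_z x` stays
bounded near `z₀`, then the rank of `x` is at most `n`. -/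
lemma mem_kerPow_of_isBoundedUnder (hev : ∀ᶠ z in 𝓝[≠] z₀, z ∈ resolventSet T) (n : ℕ) :
    ∀ x ∈ kerPow (shift T z₀) (n + 1),
      (∃ C : ℝ, ∀ᶠ z in 𝓝[≠] z₀, ‖(z - z₀) ^ n • resolvent T z x‖ ≤ C) →
      x ∈ kerPow (shift T z₀) n := by
  have key : ∀ x g : H, (x, g + z₀ • x) ∈ T.graph → ∀ᶠ z in 𝓝[≠] z₀,
      (z - z₀) • resolvent T z x = resolvent T z g - x := by
    intro x g hx
    filter_upwards [hev] with z hz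
    have h : resolvent T z (g - (z - z₀) • x) = x := by
      refine (isResolventAt_resolvent hz).apply_eq ?_
      convert hx using 2
      module
    rw [map_sub, map_smul] at h
    nth_rewrite 2 [← h]
    abel
  induction n with
  | zero =>
    rintro x hx ⟨C, hC⟩
    obtain ⟨g, hg, hg0⟩ := mem_kerPow_succ_shift.1 hx
    rw [(Submodule.mem_bot ℂ).1 hg0] at hg
    have h2 : ∀ᶠ z in 𝓝[≠] z₀, ‖x‖ ≤ ‖z - z₀‖ * C := by
      filter_upwards [key x 0 hg, hC] with z h1 h2
      rw [map_zero, zero_sub] at h1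
      rw [← norm_neg, ← h1, norm_smul]
      simp only [pow_zero, one_smul] at h2
      gcongr
    have h3 : Tendsto (fun z : ℂ => ‖z - z₀‖ * C) (𝓝[≠] z₀) (𝓝 (‖z₀ - z₀‖ * C)) :=
      ((by fun_prop : Continuous fun z : ℂ => ‖z - z₀‖ * C).tendsto z₀).mono_left
        nhdsWithin_le_nhds
    have h4 := ge_of_tendsto h3 h2
    simp only [sub_self, norm_zero, zero_mul, norm_le_zero_iff] at h4
    rw [h4]
    exact Submodule.zero_mem _
  | succ n ih =>
    rintro x hx ⟨C, hC⟩
    obtain ⟨g, hg, hgn⟩ := mem_kerPow_succ_shift.1 hx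
    refine mem_kerPow_succ_shift.2 ⟨g, hg, ih g hgn ⟨C + 1 * ‖x‖, ?_⟩⟩
    have hle : ∀ᶠ z in 𝓝[≠] z₀, ‖z - z₀‖ < 1 := by
      refine nhdsWithin_le_nhds ?_
      filter_upwards [Metric.ball_mem_nhds z₀ one_pos] with z hz
      simpa [dist_eq_norm] using hz
    filter_upwards [key x g hg, hC, hle] with z h1 h2 h3
    have h4 : resolvent T z g = (z - z₀) • resolvent T z x + x := by rw [h1]; abel
    rw [h4, smul_add, smul_smul, ← pow_succ]
    refine (norm_add_le _ _).trans (add_le_add h2 ?_)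
    rw [norm_smul, norm_pow]
    gcongr
    exact pow_le_one₀ (norm_nonneg _) h3.le

lemma exists_kerPow_eq (hm : MeromorphicAt (resolvent T) z₀)
    (hev : ∀ᶠ z in 𝓝[≠] z₀, z ∈ resolventSet T) :
    ∃ p, 0 < p ∧ kerPow (shift T z₀) p = kerPow (shift T z₀) (p + 1) := by
  obtain ⟨n, hn⟩ := hm
  refine ⟨n + 1, n.succ_pos, le_antisymm (kerPow_le_succ _) fun x hx => ?_⟩
  refine mem_kerPow_of_isBoundedUnder hev (n + 1) x hx ?_
  have hc : Tendsto (fun z => ‖(z - z₀) • ((z - z₀) ^ n • resolvent T z) x‖) (𝓝[≠] z₀)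
      (𝓝 ‖(z₀ - z₀) • ((z₀ - z₀) ^ n • resolvent T z₀) x‖) := by
    have : ContinuousAt (fun z => ‖(z - z₀) • ((z - z₀) ^ n • resolvent T z) x‖) z₀ := by
      have := hn.continuousAt
      fun_prop
    exact this.tendsto.mono_left nhdsWithin_le_nhds
  refine ⟨‖(z₀ - z₀) • ((z₀ - z₀) ^ n • resolvent T z₀) x‖ + 1, ?_⟩
  filter_upwards [hc.eventually (ge_mem_nhds (lt_add_one _))] with z hz
  rwa [_root_.smul_apply, smul_smul, ← pow_succ'] at hz

lemma ascent_ne_top {p : ℕ} (hp : 0 < p) (h : kerPow T p = kerPow T (p + 1)) :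
    ascent T ≠ ⊤ := by
  refine ne_top_of_le_ne_top (ENat.natCast_ne_top p) ?_
  exact iInf₂_le p ⟨hp, h⟩

lemma finiteDimensional_kerPow [FiniteDimensional ℂ (kerPow T 1)] (n : ℕ) :
    FiniteDimensional ℂ (kerPow T n) := by
  induction n with
  | zero => exact inferInstanceAs (FiniteDimensional ℂ (⊥ : Submodule ℂ H))
  | succ n ih =>
    have hk : FiniteDimensional ℂ (LinearMap.ker T.toFun) := by
      refine FiniteDimensional.of_injective
        (V₂ := kerPow T 1)
        ((T.domain.subtype.comp (LinearMap.ker T.toFun).subtype).codRestrict _ ?_) ?_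
      · rintro ⟨x, hx⟩
        exact ⟨x, by simpa [kerPow] using hx, rfl⟩
      · intro x y hxy
        have := congrArg Subtype.val hxy
        exact Subtype.ext (Subtype.ext this)
    have hc : FiniteDimensional ℂ ((kerPow T n).comap T.toFun) := by
      have hr : FiniteDimensional ℂ (((kerPow T n).comap T.toFun).map T.toFun) :=
        Submodule.finiteDimensional_of_le (Submodule.map_comap_le _ _)
      have h := Submodule.fg_of_fg_map_of_fg_inf_ker T.toFun
        (s := (kerPow T n).comap T.toFun) ((Submodule.fg_top _).1 hr.1) ?_
      · exact Module.Finite.of_fg h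
      · have : FiniteDimensional ℂ
            ((kerPow T n).comap T.toFun ⊓ LinearMap.ker T.toFun : Submodule ℂ T.domain) :=
          Submodule.finiteDimensional_of_le inf_le_right
        exact (Submodule.fg_top _).1 this.1
    change FiniteDimensional ℂ (((kerPow T n).comap T.toFun).map T.domain.subtype)
    infer_instance

lemma finiteDimensional_genEigenspace [FiniteDimensional ℂ (kerPow (shift T z) 1)] {p : ℕ}
    (h : kerPow (shift T z) p = kerPow (shift T z) (p + 1)) :
    FiniteDimensional ℂ (genEigenspace T z) := by
  have hst : ∀ k, kerPow (shift T z) (p + k) = kerPow (shift T z) p := by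
    intro k
    induction k with
    | zero => rfl
    | succ k ih =>
      rw [h, ← add_assoc]
      simp only [kerPow] at ih ⊢
      rw [ih]
  have hle : genEigenspace T z ≤ kerPow (shift T z) p := by
    refine iSup_le fun n => ?_
    rw [← hst n]
    exact monotone_nat_of_le_succ kerPow_le_succ (Nat.le_add_left n p)
  have := finiteDimensional_kerPow (T := shift T z) p
  exact Submodule.finiteDimensional_of_le hle

end Resolvent

end UnboundedOp

/-! ### Second order problems with two boundary conditions -/

namespace UnboundedOp

section BoundaryProblem

variable {H X : Type*} [NormedAddCommGroup H] [NormedSpace ℂ H] [NormedAddCommGroup X]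
  [NormedSpace ℂ X] {T : H →ₗ.[ℂ] H} {A : H →L[ℂ] X} {e : X →L[ℂ] H} {φ₁ φ₂ : X}
  {B₁ B₂ : X →L[ℂ] ℂ} {z z₀ : ℂ}

/-- An operator `T` given by a second order problem in integrated form: `T x = g` means that `x`
is represented by `y = c₁ φ₁ + c₂ φ₂ + A g` which satisfies two boundary conditions `B₁ y = 0` and
`B₂ y = 0`. Here `A` solves the inhomogeneous equation with zero initial data, and `φ₁, φ₂` span the
solutions of the homogeneous equation. -/
structure IsBoundaryProblem (T : H →ₗ.[ℂ] H) (A : H →L[ℂ] X) (e : X →L[ℂ] H) (φ₁ φ₂ : X)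
    (B₁ B₂ : X →L[ℂ] ℂ) : Prop where
  mem_graph : ∀ x g, (x, g) ∈ T.graph ↔ ∃ c₁ c₂ : ℂ, ∃ y : X, y = c₁ • φ₁ + c₂ • φ₂ + A g ∧
    e y = x ∧ B₁ y = 0 ∧ B₂ y = 0
  isUnit : ∀ z : ℂ, IsUnit (1 - z • (A ∘L e))
  indep : ∀ c₁ c₂ : ℂ, e (c₁ • φ₁ + c₂ • φ₂) = 0 → c₁ = 0 ∧ c₂ = 0
  compact : IsCompactOperator (e ∘L A)

/-- The operator that turns solutions for the parameter `0` into solutions for the parameter `z`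
with the same initial data. -/
def solOp (A : H →L[ℂ] X) (e : X →L[ℂ] H) (z : ℂ) : X →L[ℂ] X :=
  Ring.inverse (1 - z • (A ∘L e))

/-- The characteristic function: the determinant of the boundary values of the two fundamental
solutions. -/
def charFun (A : H →L[ℂ] X) (e : X →L[ℂ] H) (φ₁ φ₂ : X) (B₁ B₂ : X →L[ℂ] ℂ) (z : ℂ) : ℂ :=
  B₁ (solOp A e z φ₁) * B₂ (solOp A e z φ₂) - B₁ (solOp A e z φ₂) * B₂ (solOp A e z φ₁)

/-- The resolvent multiplied by the characteristic function, which is entire in `z`. The second and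
third summands are the rank one corrections that Cramer's rule gives for the boundary
conditions. -/
def resolventNumerator (A : H →L[ℂ] X) (e : X →L[ℂ] H) (φ₁ φ₂ : X) (B₁ B₂ : X →L[ℂ] ℂ) (z : ℂ) :
    H →L[ℂ] H :=
  e ∘L (charFun A e φ₁ φ₂ B₁ B₂ z • (solOp A e z ∘L A) +
    (solOp A e z ∘L ContinuousLinearMap.toSpanSingleton ℂ φ₁) ∘L
      (B₁ (solOp A e z φ₂) • (B₂ ∘L (solOp A e z ∘L A)) -
        B₂ (solOp A e z φ₂) • (B₁ ∘L (solOp A e z ∘L A))) +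
    (solOp A e z ∘L ContinuousLinearMap.toSpanSingleton ℂ φ₂) ∘L
      (B₂ (solOp A e z φ₁) • (B₁ ∘L (solOp A e z ∘L A)) -
        B₁ (solOp A e z φ₁) • (B₂ ∘L (solOp A e z ∘L A))))

namespace IsBoundaryProblem

variable (h : IsBoundaryProblem T A e φ₁ φ₂ B₁ B₂)
include h

lemma eq_solOp_iff {y u : X} : y = solOp A e z u ↔ y = u + z • A (e y) := by
  have hu := h.isUnit z
  constructor
  · intro hy
    have h1 : ((1 - z • (A ∘L e)) * solOp A e z) u = u := by
      rw [solOp, Ring.mul_inverse_cancel _ hu]; rfl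
    rw [mul_apply_eq_comp, ← hy] at h1
    have h2 : y - z • A (e y) = u := h1
    rw [← h2]
    abel
  · intro hy
    have h1 : (solOp A e z * (1 - z • (A ∘L e))) y = y := by
      rw [solOp, Ring.inverse_mul_cancel _ hu]; rfl
    rw [mul_apply_eq_comp] at h1
    have h2 : (1 - z • (A ∘L e)) y = u := by
      simp only [sub_apply, smul_apply, ContinuousLinearMap.comp_apply]
      nth_rewrite 1 [hy]
      simp
    rw [h2] at h1
    exact h1.symm

lemma mem_graph_add_smul {x f : H} : (x, f + z • x) ∈ T.graph ↔ ∃ c₁ c₂ : ℂ, ∃ y : X,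
    y = solOp A e z (c₁ • φ₁ + c₂ • φ₂ + A f) ∧ e y = x ∧ B₁ y = 0 ∧ B₂ y = 0 := by
  rw [h.mem_graph]
  refine exists_congr fun c₁ => exists_congr fun c₂ => exists_congr fun y => ?_
  rw [h.eq_solOp_iff]
  constructor
  · rintro ⟨h1, rfl, h3⟩
    refine ⟨?_, rfl, h3⟩
    rwa [map_add, map_smul, ← add_assoc] at h1
  · rintro ⟨h1, rfl, h3⟩
    refine ⟨?_, rfl, h3⟩
    rwa [map_add, map_smul, ← add_assoc]

lemma mem_graph_smul {x : H} : (x, z • x) ∈ T.graph ↔ ∃ c₁ c₂ : ℂ, ∃ y : X,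
    y = c₁ • solOp A e z φ₁ + c₂ • solOp A e z φ₂ ∧ e y = x ∧ B₁ y = 0 ∧ B₂ y = 0 := by
  have := h.mem_graph_add_smul (z := z) (x := x) (f := 0)
  simpa using this

lemma eq_zero_of_charFun_ne_zero (hz : charFun A e φ₁ φ₂ B₁ B₂ z ≠ 0) {x : H}
    (hx : (x, z • x) ∈ T.graph) : x = 0 := by
  obtain ⟨c₁, c₂, y, rfl, rfl, h1, h2⟩ := h.mem_graph_smul.1 hx
  simp only [map_add, map_smul, smul_eq_mul] at h1 h2
  have e1 : charFun A e φ₁ φ₂ B₁ B₂ z * c₁ = 0 := by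
    rw [charFun]
    linear_combination B₂ (solOp A e z φ₂) * h1 - B₁ (solOp A e z φ₂) * h2
  have e2 : charFun A e φ₁ φ₂ B₁ B₂ z * c₂ = 0 := by
    rw [charFun]
    linear_combination B₁ (solOp A e z φ₁) * h2 - B₂ (solOp A e z φ₁) * h1
  rw [(mul_eq_zero.1 e1).resolve_left hz, (mul_eq_zero.1 e2).resolve_left hz]
  simp

lemma isResolventAt (hz : charFun A e φ₁ φ₂ B₁ B₂ z ≠ 0) : IsResolventAt T z
    ((charFun A e φ₁ φ₂ B₁ B₂ z)⁻¹ • resolventNumerator A e φ₁ φ₂ B₁ B₂ z) := by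
  set R := (charFun A e φ₁ φ₂ B₁ B₂ z)⁻¹ • resolventNumerator A e φ₁ φ₂ B₁ B₂ z with hR
  have h1 : ∀ f, (R f, f + z • R f) ∈ T.graph := by
    intro f
    rw [h.mem_graph_add_smul]
    refine ⟨(charFun A e φ₁ φ₂ B₁ B₂ z)⁻¹ *
      (B₁ (solOp A e z φ₂) * B₂ (solOp A e z (A f)) - B₂ (solOp A e z φ₂) * B₁ (solOp A e z (A f))),
      (charFun A e φ₁ φ₂ B₁ B₂ z)⁻¹ *
      (B₂ (solOp A e z φ₁) * B₁ (solOp A e z (A f)) - B₁ (solOp A e z φ₁) * B₂ (solOp A e z (A f))),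
      _, rfl, ?_, ?_, ?_⟩
    · simp only [hR, resolventNumerator, smul_apply, ContinuousLinearMap.comp_apply, add_apply,
        sub_apply, map_add, map_smul, ContinuousLinearMap.toSpanSingleton_apply, smul_eq_mul,
        smul_add, smul_smul, inv_mul_cancel₀ hz, one_smul]
      abel
    · simp only [map_add, map_smul, smul_eq_mul]
      field_simp
      rw [charFun]
      ring
    · simp only [map_add, map_smul, smul_eq_mul]
      field_simp
      rw [charFun]
      ring
  refine isResolventAt_iff.2 ⟨h1, fun x g hx => ?_⟩
  rw [← sub_eq_zero]
  refine h.eq_zero_of_charFun_ne_zero hz ?_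
  have := Submodule.sub_mem _ (h1 (g - z • x)) hx
  convert this using 1
  rw [Prod.mk_sub_mk, smul_sub]
  congr 1
  abel

lemma mem_pointSpectrum_of_charFun_eq_zero (hz : charFun A e φ₁ φ₂ B₁ B₂ z = 0) :
    z ∈ pointSpectrum T := by
  obtain ⟨c₁, c₂, hc, h1, h2⟩ : ∃ c₁ c₂ : ℂ, ¬ (c₁ = 0 ∧ c₂ = 0) ∧
      c₁ * B₁ (solOp A e z φ₁) + c₂ * B₁ (solOp A e z φ₂) = 0 ∧
      c₁ * B₂ (solOp A e z φ₁) + c₂ * B₂ (solOp A e z φ₂) = 0 := by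
    rw [charFun] at hz
    by_cases h1 : B₁ (solOp A e z φ₁) = 0 ∧ B₁ (solOp A e z φ₂) = 0
    · by_cases h2 : B₂ (solOp A e z φ₁) = 0 ∧ B₂ (solOp A e z φ₂) = 0
      · exact ⟨1, 0, by simp, by simp [h1], by simp [h2]⟩
      · refine ⟨B₂ (solOp A e z φ₂), -B₂ (solOp A e z φ₁), ?_, by simp [h1], by ring⟩
        rwa [neg_eq_zero, and_comm]
    · refine ⟨B₁ (solOp A e z φ₂), -B₁ (solOp A e z φ₁), ?_, by ring, ?_⟩
      · rwa [neg_eq_zero, and_comm]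
      · linear_combination -hz
  refine mem_pointSpectrum.2 ⟨e (c₁ • solOp A e z φ₁ + c₂ • solOp A e z φ₂), fun h0 => hc ?_,
    h.mem_graph_smul.2 ⟨c₁, c₂, _, rfl, rfl, ?_, ?_⟩⟩
  · have hy : c₁ • solOp A e z φ₁ + c₂ • solOp A e z φ₂ = solOp A e z (c₁ • φ₁ + c₂ • φ₂) := by
      simp
    have h3 := h.eq_solOp_iff.1 hy
    rw [h0, map_zero, smul_zero, add_zero] at h3
    rw [h3] at h0
    exact h.indep _ _ h0
  · simpa using h1
  · simpa using h2

lemma mem_resolventSet_iff : z ∈ resolventSet T ↔ charFun A e φ₁ φ₂ B₁ B₂ z ≠ 0 :=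
  ⟨fun hz h0 => notMem_resolventSet (h.mem_pointSpectrum_of_charFun_eq_zero h0) hz,
    fun hz => (h.isResolventAt hz).mem⟩

lemma mem_resolventSet_of_notMem_pointSpectrum (hz : z ∉ pointSpectrum T) :
    z ∈ resolventSet T :=
  h.mem_resolventSet_iff.2 fun h0 => hz (h.mem_pointSpectrum_of_charFun_eq_zero h0)

lemma mem_pointSpectrum_of_mem_spectrum (hz : z ∈ spectrum T) : z ∈ pointSpectrum T := by
  by_contra hn
  exact hz (h.mem_resolventSet_of_notMem_pointSpectrum hn)

lemma isCompactOperator_resolvent (hz : z ∈ resolventSet T) :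
    IsCompactOperator (resolvent T z) := by
  rw [(h.isResolventAt (h.mem_resolventSet_iff.1 hz)).resolvent_eq]
  have hQ : e ∘L (solOp A e z ∘L A) =
      (e ∘L A) ∘L (1 + z • (e ∘L (solOp A e z ∘L A))) := by
    ext f
    have := h.eq_solOp_iff.1 (rfl : solOp A e z (A f) = _)
    simp only [ContinuousLinearMap.comp_apply, add_apply, smul_apply, map_add, map_smul]
    nth_rewrite 1 [this]
    simp
  have h1 : IsCompactOperator (e ∘L (solOp A e z ∘L A)) := by
    rw [hQ]
    exact h.compact.comp_clm _
  have h2 : ∀ (ℓ : H →L[ℂ] ℂ) (g : ℂ →L[ℂ] H), IsCompactOperator (g ∘L ℓ) := fun ℓ g =>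
    (isCompactOperator_of_locallyCompactSpace_dom ℓ).clm_comp g
  refine IsCompactOperator.smul ?_ _
  rw [resolventNumerator, ContinuousLinearMap.comp_add, ContinuousLinearMap.comp_add,
    ContinuousLinearMap.comp_smul, ← ContinuousLinearMap.comp_assoc e (solOp A e z ∘L _),
    ← ContinuousLinearMap.comp_assoc e (solOp A e z ∘L _)]
  simp only [ContinuousLinearMap.coe_coe, FunLike.coe_add, FunLike.coe_smul]
  exact ((h1.smul _).add (h2 _ _)).add (h2 _ _)

lemma finiteDimensional_kerPow_one : FiniteDimensional ℂ (kerPow (shift T z) 1) := by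
  have hle : kerPow (shift T z) 1 ≤
      Submodule.span ℂ {e (solOp A e z φ₁), e (solOp A e z φ₂)} := by
    intro x hx
    rw [mem_kerPow_one, mem_graph_shift, zero_add] at hx
    obtain ⟨c₁, c₂, y, rfl, rfl, -⟩ := h.mem_graph_smul.1 hx
    rw [Submodule.mem_span_pair]
    exact ⟨c₁, c₂, by simp⟩
  have := FiniteDimensional.span_of_finite ℂ
    (Set.toFinite {e (solOp A e z φ₁), e (solOp A e z φ₂)})
  exact Submodule.finiteDimensional_of_le hle

variable [CompleteSpace X]

lemma differentiable_solOp : Differentiable ℂ (solOp A e) := fun z => by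
  obtain ⟨u, hu⟩ := h.isUnit z
  have h1 : DifferentiableAt ℂ Ring.inverse (1 - z • (A ∘L e)) := by
    rw [← hu]
    exact (analyticAt_inverse u).differentiableAt
  exact DifferentiableAt.comp z h1 (by fun_prop)

lemma differentiable_charFun : Differentiable ℂ (charFun A e φ₁ φ₂ B₁ B₂) := by
  have := h.differentiable_solOp
  unfold charFun
  fun_prop

lemma differentiable_resolventNumerator :
    Differentiable ℂ (resolventNumerator A e φ₁ φ₂ B₁ B₂) := by
  have := h.differentiable_solOp
  have := h.differentiable_charFun
  unfold resolventNumerator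
  fun_prop

variable (hne : (resolventSet T).Nonempty)
include hne

lemma eventually_mem_resolventSet (z₀ : ℂ) : ∀ᶠ z in 𝓝[≠] z₀, z ∈ resolventSet T := by
  simp only [h.mem_resolventSet_iff]
  have ha : AnalyticOnNhd ℂ (charFun A e φ₁ φ₂ B₁ B₂) univ := fun z _ =>
    h.differentiable_charFun.analyticAt z
  rcases (ha z₀ (mem_univ _)).eventually_eq_zero_or_eventually_ne_zero with h0 | h0
  · obtain ⟨z, hz⟩ := hne
    exact absurd (ha.eqOn_zero_of_preconnected_of_eventuallyEq_zero isPreconnected_univ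
      (mem_univ z₀) h0 (mem_univ z)) (h.mem_resolventSet_iff.1 hz)
  · exact h0

variable [CompleteSpace H]

lemma meromorphicAt_resolvent (z₀ : ℂ) : MeromorphicAt (resolvent T) z₀ := by
  have h1 : MeromorphicAt (fun z => (charFun A e φ₁ φ₂ B₁ B₂ z)⁻¹ •
      resolventNumerator A e φ₁ φ₂ B₁ B₂ z) z₀ :=
    (h.differentiable_charFun.analyticAt z₀).meromorphicAt.inv.smul
      (h.differentiable_resolventNumerator.analyticAt z₀).meromorphicAt
  refine h1.congr ?_
  filter_upwards [h.eventually_mem_resolventSet hne z₀] with z hz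
  exact (h.isResolventAt (h.mem_resolventSet_iff.1 hz)).resolvent_eq.symm

lemma isResolventPole (hz : z₀ ∈ spectrum T) : IsResolventPole T z₀ :=
  ⟨h.eventually_mem_resolventSet hne z₀, h.meromorphicAt_resolvent hne z₀,
    meromorphicOrderAt_resolvent_neg (h.meromorphicAt_resolvent hne z₀)
      (h.eventually_mem_resolventSet hne z₀) (h.mem_pointSpectrum_of_mem_spectrum hz)⟩

lemma hasPurelyDiscreteSpectrum : HasPurelyDiscreteSpectrum T := fun z hz => by
  obtain ⟨p, -, hp⟩ := exists_kerPow_eq (h.meromorphicAt_resolvent hne z)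
    (h.eventually_mem_resolventSet hne z)
  have := h.finiteDimensional_kerPow_one (z := z)
  exact ⟨h.eventually_mem_resolventSet hne z, h.mem_pointSpectrum_of_mem_spectrum hz,
    finiteDimensional_genEigenspace hp⟩

lemma ascent_shift_ne_top (z₀ : ℂ) : ascent (shift T z₀) ≠ ⊤ := by
  obtain ⟨p, hp, hp'⟩ := exists_kerPow_eq (h.meromorphicAt_resolvent hne z₀)
    (h.eventually_mem_resolventSet hne z₀)
  exact ascent_ne_top hp hp'

end IsBoundaryProblem

end BoundaryProblem

/-- If some power of `z S` is a contraction, then `1 - z S` is invertible, because it divides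
`1 - (z S) ^ n`. -/
lemma isUnit_one_sub_smul {X : Type*} [NormedAddCommGroup X] [NormedSpace ℂ X] [CompleteSpace X]
    (S : X →L[ℂ] X) (z : ℂ) {n : ℕ} (h : ‖z‖ ^ n * ‖S ^ n‖ < 1) : IsUnit (1 - z • S) := by
  have h1 : IsUnit (1 - (z • S) ^ n) := by
    refine isUnit_one_sub_of_norm_lt_one ?_
    rwa [smul_pow, norm_smul, norm_pow]
  rw [← mul_neg_geom_sum (z • S) n] at h1
  exact ((Commute.sum_right _ _ _ fun i _ => (Commute.one_left _).sub_left
    ((Commute.refl (z • S)).pow_right i)).isUnit_mul_iff.1 h1).1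

end UnboundedOp

/-! ### Primitives of integrable functions on the unit interval -/

/-- A function whose increments are controlled by those of an absolutely continuous function is
absolutely continuous. -/
lemma AbsolutelyContinuousOnInterval.of_dist_le {X Y : Type*} [PseudoMetricSpace X]
    [PseudoMetricSpace Y] {f : ℝ → X} {g : ℝ → Y} {a b C : ℝ}
    (hf : AbsolutelyContinuousOnInterval f a b)
    (h : ∀ x ∈ uIcc a b, ∀ y ∈ uIcc a b, dist (g x) (g y) ≤ C * dist (f x) (f y)) :
    AbsolutelyContinuousOnInterval g a b := by
  have h1 : Tendsto _ _ (𝓝 (C * 0)) := Tendsto.const_mul C hf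
  rw [mul_zero] at h1
  refine squeeze_zero'
    (Eventually.of_forall fun E => Finset.sum_nonneg fun _ _ => dist_nonneg) ?_ h1
  have h2 : ∀ᶠ E : ℕ × (ℕ → ℝ × ℝ) in AbsolutelyContinuousOnInterval.totalLengthFilter ⊓
      𝓟 (AbsolutelyContinuousOnInterval.disjWithin a b),
      E ∈ AbsolutelyContinuousOnInterval.disjWithin a b :=
    eventually_inf_principal.mpr (by simp)
  filter_upwards [h2] with E hE
  rw [Finset.mul_sum]
  exact Finset.sum_le_sum fun i hi => h _ (hE.1 i hi).1 _ (hE.1 i hi).2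

namespace JumpDiffusion

section Primitive

variable {E : Type*} [NormedAddCommGroup E] [NormedSpace ℝ E] {k l : ℝ → E} {x : ℝ}

/-- The primitive `x ↦ ∫₀ˣ k` of a function on `(0, 1)`, extended to the real line as a function
that is constant to the left of `0` and to the right of `1`. -/
def prim (k : ℝ → E) (x : ℝ) : E := ∫ t in (0 : ℝ)..x, (Ioo (0 : ℝ) 1).indicator k t

@[simp] lemma prim_zero (k : ℝ → E) : prim k 0 = 0 := intervalIntegral.integral_same

omit [NormedSpace ℝ E] in
lemma intervalIntegrable_indicator (hk : IntegrableOn k (Ioo 0 1)) (a b : ℝ) :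
    IntervalIntegrable ((Ioo (0 : ℝ) 1).indicator k) volume a b :=
  ((integrable_indicator_iff measurableSet_Ioo).2 hk).intervalIntegrable

lemma continuous_prim (hk : IntegrableOn k (Ioo 0 1)) : Continuous (prim k) :=
  intervalIntegral.continuous_primitive (intervalIntegrable_indicator hk) 0

lemma prim_sub_prim (hk : IntegrableOn k (Ioo 0 1)) (a b : ℝ) :
    prim k b - prim k a = ∫ t in a..b, (Ioo (0 : ℝ) 1).indicator k t :=
  intervalIntegral.integral_interval_sub_left (intervalIntegrable_indicator hk _ _)
    (intervalIntegrable_indicator hk _ _)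

lemma prim_add (hk : IntegrableOn k (Ioo 0 1)) (hl : IntegrableOn l (Ioo 0 1)) (x : ℝ) :
    prim (fun t => k t + l t) x = prim k x + prim l x := by
  rw [prim, prim, prim, ← intervalIntegral.integral_add (intervalIntegrable_indicator hk _ _)
    (intervalIntegrable_indicator hl _ _)]
  congr 1
  exact indicator_add _ k l

lemma prim_smul {𝕜 : Type*} [RCLike 𝕜] [NormedSpace 𝕜 E] [SMulCommClass ℝ 𝕜 E] (c : 𝕜)
    (k : ℝ → E) (x : ℝ) : prim (fun t => c • k t) x = c • prim k x := by
  rw [prim, prim, ← intervalIntegral.integral_smul]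
  congr 1
  exact indicator_const_smul _ c k

lemma prim_neg (k : ℝ → E) (x : ℝ) : prim (fun t => -k t) x = -prim k x := by
  rw [prim, prim, ← intervalIntegral.integral_neg]
  congr 1
  exact indicator_neg _ k

lemma prim_congr_ae (h : k =ᵐ[volume.restrict (Ioo (0 : ℝ) 1)] l) : prim k = prim l := by
  funext x
  rw [prim, prim]
  refine intervalIntegral.integral_congr_ae_restrict (ae_restrict_of_ae ?_)
  rw [EventuallyEq, ae_restrict_iff' measurableSet_Ioo] at h
  filter_upwards [h] with t ht
  by_cases hm : t ∈ Ioo (0 : ℝ) 1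
  · simp only [indicator_of_mem hm, ht hm]
  · simp only [indicator_of_notMem hm]

lemma norm_prim_le (hk : IntegrableOn k (Ioo 0 1)) (x : ℝ) :
    ‖prim k x‖ ≤ ∫ t in Ioo (0 : ℝ) 1, ‖k t‖ := by
  have hi := ((integrable_indicator_iff measurableSet_Ioo).2 hk).norm
  refine intervalIntegral.norm_integral_le_integral_norm_uIoc.trans ?_
  refine (setIntegral_le_integral hi (ae_of_all _ fun _ => norm_nonneg _)).trans_eq ?_
  rw [← integral_indicator measurableSet_Ioo]
  simp_rw [norm_indicator_eq_indicator_norm]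

/-- Increments of a primitive are bounded by those of the primitive of a bound. -/
lemma norm_prim_sub_le {m : ℝ → ℝ} (hk : IntegrableOn k (Ioo 0 1)) (hm : IntegrableOn m (Ioo 0 1))
    {a b : ℝ} (hab : a ≤ b)
    (h : ∀ᵐ t ∂volume.restrict (Ioo (0 : ℝ) 1), a < t → t ≤ b → ‖k t‖ ≤ m t) :
    ‖prim k b - prim k a‖ ≤ prim m b - prim m a := by
  rw [prim_sub_prim hk, prim_sub_prim hm]
  refine intervalIntegral.norm_integral_le_of_norm_le hab ?_ (intervalIntegrable_indicator hm _ _)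
  rw [ae_restrict_iff' measurableSet_Ioo] at h
  filter_upwards [h] with t ht hI
  by_cases hI1 : t ∈ Ioo (0 : ℝ) 1
  · simpa only [indicator_of_mem hI1] using ht hI1 hI.1 hI.2
  · simp only [indicator_of_notMem hI1, norm_zero, le_refl]

lemma norm_prim_le_prim {m : ℝ → ℝ} (hk : IntegrableOn k (Ioo 0 1))
    (hm : IntegrableOn m (Ioo 0 1)) (hx : 0 ≤ x)
    (h : ∀ᵐ t ∂volume.restrict (Ioo (0 : ℝ) 1), t ≤ x → ‖k t‖ ≤ m t) :
    ‖prim k x‖ ≤ prim m x := by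
  simpa using norm_prim_sub_le hk hm hx (h.mono fun t ht _ => ht)

lemma prim_mono {m : ℝ → ℝ} (hm : IntegrableOn m (Ioo 0 1))
    (h0 : ∀ᵐ t ∂volume.restrict (Ioo (0 : ℝ) 1), 0 ≤ m t) : Monotone (prim m) := by
  intro a b hab
  have := norm_prim_sub_le (k := fun _ => (0 : ℝ)) (integrableOn_zero) hm hab
    (h0.mono fun t ht _ _ => by simpa using ht)
  exact sub_nonneg.1 ((norm_nonneg _).trans this)

lemma prim_one_eq (m : ℝ → E) : prim m 1 = ∫ t in Ioo (0 : ℝ) 1, m t := by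
  rw [prim, intervalIntegral.integral_of_le zero_le_one, integral_Ioc_eq_integral_Ioo,
    setIntegral_indicator measurableSet_Ioo, inter_self]

lemma prim_projIcc (hk : IntegrableOn k (Ioo 0 1)) (x : ℝ) :
    prim k (projIcc (0 : ℝ) 1 zero_le_one x) = prim k x := by
  have key : ∀ a b : ℝ, (∀ t ∈ uIoc a b, t ∉ Ioo (0 : ℝ) 1) → prim k b = prim k a := by
    intro a b h
    rw [← sub_eq_zero, prim_sub_prim hk]
    refine intervalIntegral.integral_zero_ae (ae_of_all _ fun t ht => ?_)
    rw [indicator_of_notMem (h t ht)]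
  rcases le_total x 0 with hx | hx
  · rw [projIcc_of_le_left _ hx]
    refine key _ _ fun t ht ht' => ?_
    rw [uIoc_of_le hx] at ht
    exact absurd ht'.1 (not_lt.2 ht.2)
  · rcases le_total x 1 with hx1 | hx1
    · rw [projIcc_of_mem _ ⟨hx, hx1⟩]
    · rw [projIcc_of_right_le _ hx1]
      refine (key _ _ fun t ht ht' => ?_).symm
      rw [uIoc_of_le hx1] at ht
      exact absurd ht'.2 (not_lt.2 ht.1.le)

lemma prim_eq_integral (hx : x ∈ Icc (0 : ℝ) 1) : prim k x = ∫ t in (0 : ℝ)..x, k t := by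
  rw [prim]
  refine intervalIntegral.integral_congr_ae ?_
  have h1 : ∀ᵐ t : ℝ, t ≠ 1 := by simp [ae_iff, measure_singleton]
  filter_upwards [h1] with t ht hI
  rw [uIoc_of_le hx.1] at hI
  have hI1 : t ∈ Ioo (0 : ℝ) 1 := ⟨hI.1, lt_of_le_of_ne (hI.2.trans hx.2) ht⟩
  exact indicator_of_mem hI1 _

variable [CompleteSpace E]

lemma hasDerivWithinAt_prim (hk : Continuous k) (hx : x ∈ Icc (0 : ℝ) 1) :
    HasDerivWithinAt (prim k) (k x) (Icc 0 1) x := by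
  have h1 : HasDerivAt (fun u => ∫ t in (0 : ℝ)..u, k t) (k x) x :=
    intervalIntegral.integral_hasDerivAt_right (hk.intervalIntegrable _ _)
      hk.aestronglyMeasurable.stronglyMeasurableAtFilter hk.continuousAt
  exact h1.hasDerivWithinAt.congr (fun y hy => prim_eq_integral hy) (prim_eq_integral hx)

lemma ae_hasDerivAt_prim (hk : IntegrableOn k (Ioo 0 1)) :
    ∀ᵐ x ∂volume.restrict (Ioo (0 : ℝ) 1), HasDerivAt (prim k) (k x) x := by
  rw [ae_restrict_iff' measurableSet_Ioo]
  have := LocallyIntegrable.ae_hasDerivAt_integral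
    ((integrable_indicator_iff measurableSet_Ioo).2 hk).locallyIntegrable
  filter_upwards [this] with x hx hI
  have h := hx 0
  rwa [indicator_of_mem hI] at h

omit [CompleteSpace E] in
lemma ac_prim (hk : IntegrableOn k (Ioo 0 1)) : AbsolutelyContinuousOnInterval (prim k) 0 1 := by
  have h1 := IntervalIntegrable.absolutelyContinuousOnInterval_intervalIntegral
    (intervalIntegrable_indicator hk.norm 0 1) (c := 0) (by simp)
  refine h1.of_dist_le (C := 1) ?_
  have key : ∀ a b : ℝ, a ≤ b → dist (prim k a) (prim k b) ≤
      1 * dist (prim (fun t => ‖k t‖) a) (prim (fun t => ‖k t‖) b) := by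
    intro a b hab
    rw [one_mul, dist_comm, dist_eq_norm, dist_comm, Real.dist_eq]
    exact (norm_prim_sub_le hk hk.norm hab (by simp)).trans (le_abs_self _)
  intro a _ b _
  rcases le_total a b with hab | hab
  · exact key a b hab
  · rw [dist_comm, dist_comm (∫ _ in _.._, _)]
    exact key b a hab

/-- The fundamental theorem of calculus for absolutely continuous functions. -/
lemma eq_add_prim {g : ℝ → E} (hg : AbsolutelyContinuousOnInterval g 0 1)
    (hk : IntegrableOn k (Ioo 0 1))
    (h : ∀ᵐ x ∂volume.restrict (Ioo (0 : ℝ) 1), HasDerivAt g (k x) x) (hx : x ∈ Icc (0 : ℝ) 1) :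
    g x = g 0 + prim k x := by
  have h1 : ∀ᵐ x, x ∈ uIcc (0 : ℝ) 1 → HasDerivAt (g - prim k) 0 x := by
    have h2 := h.and (ae_hasDerivAt_prim hk)
    rw [restrict_Ioo_eq_restrict_Icc, ae_restrict_iff' measurableSet_Icc] at h2
    rw [uIcc_of_le zero_le_one]
    filter_upwards [h2] with x hx hI
    simpa using (hx hI).1.sub (hx hI).2
  obtain ⟨C, hC⟩ := (hg.sub (ac_prim hk)).const_of_ae_hasDerivAt_zero h1
  rw [uIcc_of_le zero_le_one] at hC
  have h3 := hC x hx
  have h4 := hC 0 (by simp)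
  simp only [Pi.sub_apply, prim_zero, sub_zero] at h3 h4
  rw [h4, ← h3]
  abel

end Primitive

section ExpPrim

variable {k : ℝ → ℂ} {x : ℝ}

/-- The exponential `exp (∫₀ˣ k)` of a primitive: an integrating factor. -/
def expPrim (k : ℝ → ℂ) (x : ℝ) : ℂ := Complex.exp (prim k x)

lemma expPrim_ne_zero (k : ℝ → ℂ) (x : ℝ) : expPrim k x ≠ 0 := Complex.exp_ne_zero _

@[simp] lemma expPrim_zero (k : ℝ → ℂ) : expPrim k 0 = 1 := by simp [expPrim]

lemma expPrim_neg (k : ℝ → ℂ) (x : ℝ) : expPrim (fun t => -k t) x = (expPrim k x)⁻¹ := by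
  rw [expPrim, expPrim, prim_neg, Complex.exp_neg]

lemma continuous_expPrim (hk : IntegrableOn k (Ioo 0 1)) : Continuous (expPrim k) :=
  Complex.continuous_exp.comp (continuous_prim hk)

lemma norm_expPrim_le (hk : IntegrableOn k (Ioo 0 1)) (x : ℝ) :
    ‖expPrim k x‖ ≤ Real.exp (∫ t in Ioo (0 : ℝ) 1, ‖k t‖) := by
  rw [expPrim]
  exact (Complex.norm_exp_le_exp_norm _).trans (Real.exp_le_exp.2 (norm_prim_le hk x))

lemma norm_expPrim_inv_le (hk : IntegrableOn k (Ioo 0 1)) (x : ℝ) :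
    ‖(expPrim k x)⁻¹‖ ≤ Real.exp (∫ t in Ioo (0 : ℝ) 1, ‖k t‖) := by
  rw [← expPrim_neg]
  simpa using norm_expPrim_le (k := fun t => -k t) hk.neg x

lemma ae_hasDerivAt_expPrim (hk : IntegrableOn k (Ioo 0 1)) :
    ∀ᵐ x ∂volume.restrict (Ioo (0 : ℝ) 1), HasDerivAt (expPrim k) (expPrim k x * k x) x := by
  filter_upwards [ae_hasDerivAt_prim hk] with x hx
  exact hx.cexp

lemma ac_expPrim (hk : IntegrableOn k (Ioo 0 1)) :
    AbsolutelyContinuousOnInterval (expPrim k) 0 1 := by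
  refine (ac_prim hk).of_dist_le (C := Real.exp (∫ t in Ioo (0 : ℝ) 1, ‖k t‖)) ?_
  intro a _ b _
  rw [dist_eq_norm, dist_eq_norm]
  refine Convex.norm_image_sub_le_of_norm_deriv_le (f := Complex.exp)
    (s := Metric.closedBall 0 (∫ t in Ioo (0 : ℝ) 1, ‖k t‖)) (fun z _ => by fun_prop) ?_
    (convex_closedBall _ _) ?_ ?_
  · intro z hz
    rw [Complex.deriv_exp]
    exact (Complex.norm_exp_le_exp_norm _).trans (Real.exp_le_exp.2 (by simpa using hz))
  · simpa using norm_prim_le hk b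
  · simpa using norm_prim_le hk a

end ExpPrim

end JumpDiffusion

/-! ### The Volterra operator -/

namespace JumpDiffusion

open BoundedContinuousFunction

/-- The standing assumptions on the leading coefficient: `b₀ < 0` a.e. and `w = -1 / b₀` is
integrable on `(0, 1)`. -/
class IsWeight (b₀ : ℝ → ℝ) : Prop where
  neg : ∀ᵐ x ∂volume.restrict (Ioo (0 : ℝ) 1), b₀ x < 0
  integrableOn : IntegrableOn (fun x => -1 / b₀ x) (Ioo 0 1)

/-- The standing assumption on the drift: `b₁ / b₀` is integrable on `(0, 1)`. -/
class IsDrift (b₀ : ℝ → ℝ) (b₁ : ℝ → ℂ) : Prop where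
  integrableOn : IntegrableOn (fun x => b₁ x / (b₀ x : ℂ)) (Ioo 0 1)

section Weight

variable (b₀ : ℝ → ℝ)

/-- The weight `w = -1 / b₀`. -/
def weight (x : ℝ) : ℝ := -1 / b₀ x

variable [hw : IsWeight b₀]

lemma ae_weight_pos : ∀ᵐ x ∂volume.restrict (Ioo (0 : ℝ) 1), 0 < weight b₀ x := by
  filter_upwards [hw.neg] with x hx
  exact div_pos_of_neg_of_neg (by norm_num) hx

lemma integrableOn_weight : IntegrableOn (weight b₀) (Ioo 0 1) := hw.integrableOn

instance isFiniteMeasure_wMeasure : IsFiniteMeasure (wMeasure b₀) :=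
  isFiniteMeasure_withDensity_ofReal hw.integrableOn.2

variable {b₀}

lemma ae_wMeasure_iff {q : ℝ → Prop} :
    (∀ᵐ x ∂wMeasure b₀, q x) ↔ ∀ᵐ x ∂volume.restrict (Ioo (0 : ℝ) 1), q x :=
  ⟨ae_of_ae_wMeasure hw.neg hw.integrableOn,
    fun h => (withDensity_absolutelyContinuous _ _).ae_le h⟩

lemma integrableOn_weight_mul {g : ℝ → ℂ} (hg : Integrable g (wMeasure b₀)) :
    IntegrableOn (fun t => (weight b₀ t : ℂ) * g t) (Ioo 0 1) := by
  rw [wMeasure, integrable_withDensity_iff_integrable_smul₀'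
    hw.integrableOn.aestronglyMeasurable.aemeasurable.ennreal_ofReal (by simp)] at hg
  refine hg.congr ?_
  filter_upwards [ae_weight_pos b₀] with t ht
  change (ENNReal.ofReal (weight b₀ t)).toReal • g t = _
  rw [ENNReal.toReal_ofReal ht.le, Complex.real_smul]

lemma integral_norm_weight_mul (g : ℝ → ℂ) :
    ∫ t in Ioo (0 : ℝ) 1, ‖(weight b₀ t : ℂ) * g t‖ = ∫ t, ‖g t‖ ∂wMeasure b₀ := by
  rw [wMeasure, integral_withDensity_eq_integral_toReal_smul₀
    hw.integrableOn.aestronglyMeasurable.aemeasurable.ennreal_ofReal (by simp)]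
  refine integral_congr_ae ?_
  filter_upwards [ae_weight_pos b₀] with t ht
  change _ = (ENNReal.ofReal (weight b₀ t)).toReal • ‖g t‖
  rw [ENNReal.toReal_ofReal ht.le, norm_mul, Complex.norm_real, Real.norm_of_nonneg ht.le,
    smul_eq_mul]

lemma integrable_coeFn (g : L2w b₀) : Integrable g (wMeasure b₀) :=
  (Lp.memLp g).integrable (by norm_num)

lemma integral_norm_le (g : L2w b₀) :
    ∫ t, ‖g t‖ ∂wMeasure b₀ ≤ (wMeasure b₀ univ ^ (1 / 2 : ℝ)).toReal * ‖g‖ := by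
  have h := eLpNorm_le_eLpNorm_mul_rpow_measure_univ (p := 1) (q := 2) (by norm_num)
    (Lp.memLp g).1
  have hfin : wMeasure b₀ univ ^ (1 / 2 : ℝ) ≠ ⊤ :=
    ENNReal.rpow_ne_top_of_nonneg (by norm_num) (measure_ne_top _ _)
  rw [integral_norm_eq_lintegral_enorm (Lp.memLp g).1, ← eLpNorm_one_eq_lintegral_enorm,
    Lp.norm_def, mul_comm, ← ENNReal.toReal_mul]
  refine ENNReal.toReal_mono (ENNReal.mul_ne_top (Lp.memLp g).2.ne hfin) ?_
  convert h using 3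
  norm_num

end Weight

section Operators

variable (b₀ : ℝ → ℝ) (b₁ : ℝ → ℂ)

/-- The coefficient `b₁ / b₀` of `y'` in the normalized equation `y'' + (b₁ / b₀) y' = g / b₀`. -/
def drift (x : ℝ) : ℂ := b₁ x / (b₀ x : ℂ)

/-- The density `p w g` of the decrement of `p y'`, for a solution `y` of `b₀ y'' + b₁ y' = g` with
integrating factor `p = exp ∫ b₁ / b₀`. -/
def flux (g : ℝ → ℂ) (t : ℝ) : ℂ := expPrim (drift b₀ b₁) t * ((weight b₀ t : ℂ) * g t)

/-- The bounded continuous function on the real line given by a primitive. -/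
def primBCF (k : ℝ → ℂ) (hk : IntegrableOn k (Ioo 0 1)) : ℝ →ᵇ ℂ :=
  ofNormedAddCommGroup (prim k) (continuous_prim hk) _ (norm_prim_le hk)

@[simp] lemma primBCF_apply (k : ℝ → ℂ) (hk : IntegrableOn k (Ioo 0 1)) (x : ℝ) :
    primBCF k hk x = prim k x := rfl

/-- A common bound for the integrating factor and its inverse. -/
def factorBound : ℝ := Real.exp (∫ t in Ioo (0 : ℝ) 1, ‖drift b₀ b₁ t‖)

lemma factorBound_pos : 0 < factorBound b₀ b₁ := Real.exp_pos _

variable [hb : IsDrift b₀ b₁]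

lemma integrableOn_drift : IntegrableOn (drift b₀ b₁) (Ioo 0 1) := hb.integrableOn

lemma norm_factor_le (x : ℝ) : ‖expPrim (drift b₀ b₁) x‖ ≤ factorBound b₀ b₁ :=
  norm_expPrim_le hb.integrableOn x

lemma norm_factor_inv_le (x : ℝ) : ‖(expPrim (drift b₀ b₁) x)⁻¹‖ ≤ factorBound b₀ b₁ :=
  norm_expPrim_inv_le hb.integrableOn x

lemma continuous_factor_inv : Continuous fun x => (expPrim (drift b₀ b₁) x)⁻¹ :=
  (continuous_expPrim hb.integrableOn).inv₀ (expPrim_ne_zero _)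

lemma continuous_factor_inv_mul {h : ℝ → ℂ} (hh : Continuous h) :
    Continuous fun x => (expPrim (drift b₀ b₁) x)⁻¹ * h x :=
  (continuous_factor_inv b₀ b₁).mul hh

lemma _root_.Continuous.integrableOn_Ioo_zero_one {h : ℝ → ℂ} (hh : Continuous h) :
    IntegrableOn h (Ioo 0 1) :=
  (hh.integrableOn_Icc (a := 0) (b := 1)).mono_set Ioo_subset_Icc_self

/-- The operator `h ↦ ∫₀ˣ h / p` on bounded continuous functions. -/
def primFactorInv : (ℝ →ᵇ ℂ) →L[ℂ] (ℝ →ᵇ ℂ) :=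
  LinearMap.mkContinuous
    { toFun := fun h => primBCF (fun x => (expPrim (drift b₀ b₁) x)⁻¹ * h x)
        (continuous_factor_inv_mul b₀ b₁ h.continuous).integrableOn_Ioo_zero_one
      map_add' := fun h k => by
        ext x
        simp only [primBCF_apply, BoundedContinuousFunction.add_apply, mul_add]
        exact prim_add (continuous_factor_inv_mul b₀ b₁ h.continuous).integrableOn_Ioo_zero_one
          (continuous_factor_inv_mul b₀ b₁ k.continuous).integrableOn_Ioo_zero_one x
      map_smul' := fun c h => by
        ext x
        simp only [primBCF_apply, BoundedContinuousFunction.smul_apply, RingHom.id_apply,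
          mul_smul_comm]
        exact prim_smul c _ x } (factorBound b₀ b₁) fun h => by
    refine (norm_le (mul_nonneg (factorBound_pos b₀ b₁).le (norm_nonneg h))).2 fun x => ?_
    refine (norm_prim_le (continuous_factor_inv_mul b₀ b₁
      h.continuous).integrableOn_Ioo_zero_one x).trans ?_
    have h1 : ∫ t in Ioo (0 : ℝ) 1, ‖(expPrim (drift b₀ b₁) t)⁻¹ * h t‖ ≤
        ∫ t in Ioo (0 : ℝ) 1, factorBound b₀ b₁ * ‖h‖ := by
      refine integral_mono
        (continuous_factor_inv_mul b₀ b₁ h.continuous).integrableOn_Ioo_zero_one.norm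
        (integrable_const _) fun t => ?_
      simp only [norm_mul]
      gcongr
      · exact (factorBound_pos b₀ b₁).le
      · exact norm_factor_inv_le b₀ b₁ t
      · exact h.norm_coe_le_norm t
    simpa using h1

lemma primFactorInv_apply (h : ℝ →ᵇ ℂ) (x : ℝ) :
    primFactorInv b₀ b₁ h x = prim (fun x => (expPrim (drift b₀ b₁) x)⁻¹ * h x) x := rfl

/-- The range of `primFactorInv` on the unit ball is uniformly Lipschitz, so the operator is compact
by the Arzelà–Ascoli theorem. -/
lemma isCompactOperator_primFactorInv : IsCompactOperator (primFactorInv b₀ b₁) := by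
  rw [isCompactOperator_iff_exists_mem_nhds_image_subset_compact]
  let r : (ℝ →ᵇ ℂ) → (Icc (0 : ℝ) 1 →ᵇ ℂ) := fun h => h.compContinuous ⟨Subtype.val, by fun_prop⟩
  let ext : (Icc (0 : ℝ) 1 →ᵇ ℂ) → (ℝ →ᵇ ℂ) := fun h =>
    h.compContinuous ⟨projIcc (0 : ℝ) 1 zero_le_one, continuous_projIcc⟩
  have hext : Continuous ext := continuous_compContinuous _
  let F : Set (Icc (0 : ℝ) 1 →ᵇ ℂ) := (fun h => r (primFactorInv b₀ b₁ h)) '' Metric.closedBall 0 1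
  have hM := (factorBound_pos b₀ b₁).le
  have hlip : ∀ h ∈ Metric.closedBall (0 : ℝ →ᵇ ℂ) 1,
      LipschitzWith (factorBound b₀ b₁).toNNReal (r (primFactorInv b₀ b₁ h)) := by
    intro h hh
    have key : ∀ a b : Icc (0 : ℝ) 1, a ≤ b →
        ‖primFactorInv b₀ b₁ h b - primFactorInv b₀ b₁ h a‖ ≤ factorBound b₀ b₁ * (b - a) := by
      intro a b hab
      have := norm_prim_sub_le (m := fun _ => factorBound b₀ b₁)
        (continuous_factor_inv_mul b₀ b₁ h.continuous).integrableOn_Ioo_zero_one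
        (integrable_const _) hab (ae_of_all _ fun t _ _ => ?_)
      · refine this.trans_eq ?_
        rw [prim_eq_integral b.2, prim_eq_integral a.2]
        simp
        ring
      · rw [norm_mul, ← mul_one (factorBound b₀ b₁)]
        refine mul_le_mul (norm_factor_inv_le b₀ b₁ t) ?_ (norm_nonneg _) hM
        exact (h.norm_coe_le_norm t).trans (by simpa using hh)
    refine LipschitzWith.of_dist_le_mul fun a b => ?_
    rw [Real.coe_toNNReal _ hM]
    rcases le_total a b with hab | hab
    · rw [dist_comm, dist_eq_norm, dist_comm a b, Subtype.dist_eq, Real.dist_eq,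
        abs_of_nonneg (sub_nonneg.2 (show (a : ℝ) ≤ b from hab))]
      exact key a b hab
    · rw [dist_eq_norm, Subtype.dist_eq, Real.dist_eq,
        abs_of_nonneg (sub_nonneg.2 (show (b : ℝ) ≤ a from hab))]
      exact key b a hab
  have hF : IsCompact (closure F) := by
    refine arzela_ascoli (Metric.closedBall 0 ‖primFactorInv b₀ b₁‖) (isCompact_closedBall _ _) F
      ?_ ?_
    · rintro _ x ⟨h, hh, rfl⟩
      rw [mem_closedBall_zero_iff] at hh ⊢
      refine ((primFactorInv b₀ b₁ h).norm_coe_le_norm x).trans ?_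
      refine ((primFactorInv b₀ b₁).le_opNorm h).trans ?_
      exact mul_le_of_le_one_right (norm_nonneg _) hh
    · refine (LipschitzWith.uniformEquicontinuous _ (factorBound b₀ b₁).toNNReal ?_).equicontinuous
      rintro ⟨_, h, hh, rfl⟩
      exact hlip h hh
  refine ⟨Metric.closedBall 0 1, Metric.closedBall_mem_nhds _ one_pos, ext '' closure F,
    hF.image hext, ?_⟩
  rintro _ ⟨h, hh, rfl⟩
  refine ⟨_, subset_closure ⟨h, hh, rfl⟩, ?_⟩
  ext x
  exact prim_projIcc (continuous_factor_inv_mul b₀ b₁ h.continuous).integrableOn_Ioo_zero_one x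

variable [hw : IsWeight b₀]

lemma integrableOn_flux {g : ℝ → ℂ} (hg : Integrable g (wMeasure b₀)) :
    IntegrableOn (flux b₀ b₁ g) (Ioo 0 1) :=
  Integrable.bdd_mul (integrableOn_weight_mul hg)
    (continuous_expPrim hb.integrableOn).aestronglyMeasurable
    (ae_of_all _ (norm_factor_le b₀ b₁))

/-- The operator `g ↦ ∫₀ˣ p w g`. -/
def primFlux : L2w b₀ →L[ℂ] (ℝ →ᵇ ℂ) :=
  LinearMap.mkContinuous
    { toFun := fun g => primBCF (flux b₀ b₁ g) (integrableOn_flux b₀ b₁ (integrable_coeFn g))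
      map_add' := fun f g => by
        ext x
        simp only [primBCF_apply, BoundedContinuousFunction.add_apply]
        rw [← prim_add (integrableOn_flux b₀ b₁ (integrable_coeFn f))
          (integrableOn_flux b₀ b₁ (integrable_coeFn g))]
        refine congrFun (prim_congr_ae ?_) x
        filter_upwards [ae_wMeasure_iff.1 (Lp.coeFn_add f g)] with t ht
        rw [flux, ht, flux, flux, Pi.add_apply]
        ring
      map_smul' := fun c f => by
        ext x
        simp only [primBCF_apply, BoundedContinuousFunction.smul_apply, RingHom.id_apply]
        rw [← prim_smul]
        refine congrFun (prim_congr_ae ?_) x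
        filter_upwards [ae_wMeasure_iff.1 (Lp.coeFn_smul c f)] with t ht
        rw [flux, ht, flux, Pi.smul_apply, smul_eq_mul, smul_eq_mul]
        ring } (factorBound b₀ b₁ * (wMeasure b₀ univ ^ (1 / 2 : ℝ)).toReal) fun g => by
    have hM := (factorBound_pos b₀ b₁).le
    refine (norm_le (by positivity)).2 fun x => ?_
    refine (norm_prim_le (integrableOn_flux b₀ b₁ (integrable_coeFn g)) x).trans ?_
    rw [mul_assoc]
    refine le_trans ?_ (mul_le_mul_of_nonneg_left (integral_norm_le g) hM)
    rw [← integral_norm_weight_mul, ← integral_const_mul]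
    refine integral_mono (integrableOn_flux b₀ b₁ (integrable_coeFn g)).norm
      ((integrableOn_weight_mul (integrable_coeFn g)).norm.const_mul _) fun t => ?_
    rw [flux, norm_mul]
    gcongr
    exact norm_factor_le b₀ b₁ t

lemma primFlux_apply (g : L2w b₀) (x : ℝ) : primFlux b₀ b₁ g x = prim (flux b₀ b₁ g) x := rfl

/-- The solution operator of `b₀ y'' + b₁ y' = g` with `y(0) = y'(0) = 0`. -/
def volterra : L2w b₀ →L[ℂ] (ℝ →ᵇ ℂ) := -(primFactorInv b₀ b₁ ∘L primFlux b₀ b₁)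

/-- The class in `L²_w(J, ℂ)` of a bounded continuous function. -/
def toL2w : (ℝ →ᵇ ℂ) →L[ℂ] L2w b₀ := toLp 2 (wMeasure b₀) ℂ

lemma coeFn_toL2w (y : ℝ →ᵇ ℂ) : toL2w b₀ y =ᵐ[wMeasure b₀] y :=
  coeFn_toLp (p := 2) (wMeasure b₀) ℂ y

lemma volterra_apply (g : L2w b₀) (x : ℝ) : volterra b₀ b₁ g x =
    -prim (fun t => (expPrim (drift b₀ b₁) t)⁻¹ * prim (flux b₀ b₁ g) t) x := rfl

lemma isCompactOperator_toL2w_comp_volterra : IsCompactOperator (toL2w b₀ ∘L volterra b₀ b₁) := by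
  rw [volterra, ContinuousLinearMap.comp_neg]
  exact (((isCompactOperator_primFactorInv b₀ b₁).comp_clm _).clm_comp (toL2w b₀)).neg

/-- The constant in the Volterra estimate. -/
def volterraBound : ℝ :=
  factorBound b₀ b₁ * (factorBound b₀ b₁ * ∫ t in Ioo (0 : ℝ) 1, weight b₀ t)

omit hb in
lemma volterraBound_nonneg : 0 ≤ volterraBound b₀ b₁ := by
  have h1 := (factorBound_pos b₀ b₁).le
  have h2 : 0 ≤ ∫ t in Ioo (0 : ℝ) 1, weight b₀ t :=
    integral_nonneg_of_ae ((ae_weight_pos b₀).mono fun t ht => ht.le)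
  unfold volterraBound
  positivity

lemma norm_volterra_toL2w_le {y : ℝ →ᵇ ℂ} {K : ℝ} (hK : 0 ≤ K) {n : ℕ}
    (hy : ∀ t ∈ Icc (0 : ℝ) 1, ‖y t‖ ≤ K * t ^ n) {x : ℝ} (hx : x ∈ Icc (0 : ℝ) 1) :
    ‖volterra b₀ b₁ (toL2w b₀ y) x‖ ≤ volterraBound b₀ b₁ * K / (n + 1) * x ^ (n + 1) := by
  set M := factorBound b₀ b₁ with hM
  have hM0 : 0 < M := factorBound_pos b₀ b₁
  have hi := integrableOn_flux b₀ b₁ (integrable_coeFn (toL2w b₀ y))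
  have h1 : ∀ t ∈ Icc (0 : ℝ) 1, ‖prim (flux b₀ b₁ (toL2w b₀ y)) t‖ ≤
      K * t ^ n * M * ∫ s in Ioo (0 : ℝ) 1, weight b₀ s := by
    intro t ht
    have h2 : ‖prim (flux b₀ b₁ (toL2w b₀ y)) t‖ ≤
        prim (fun s => (K * t ^ n * M) • weight b₀ s) t := by
      refine norm_prim_le_prim hi (Integrable.smul (K * t ^ n * M) (integrableOn_weight b₀)) ht.1 ?_
      filter_upwards [ae_wMeasure_iff.1 (coeFn_toL2w b₀ y), ae_weight_pos b₀,
        ae_restrict_mem measurableSet_Ioo] with s hs hws hsI hst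
      rw [flux, hs, norm_mul, norm_mul, Complex.norm_real, Real.norm_of_nonneg hws.le, smul_eq_mul]
      have h3 : ‖y s‖ ≤ K * t ^ n := (hy s (Ioo_subset_Icc_self hsI)).trans (by
        have := hsI.1.le
        gcongr)
      calc _ ≤ M * (weight b₀ s * (K * t ^ n)) := by
            gcongr
            exact norm_factor_le b₀ b₁ s
        _ = _ := by ring
    refine h2.trans ?_
    rw [prim_smul, smul_eq_mul]
    have := ht.1
    gcongr
    rw [← prim_one_eq]
    exact prim_mono (integrableOn_weight b₀) ((ae_weight_pos b₀).mono fun t ht => ht.le) ht.2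
  rw [volterra_apply, norm_neg]
  have hpow : IntegrableOn (fun t : ℝ => (volterraBound b₀ b₁ * K) • t ^ n) (Ioo 0 1) :=
    (((by fun_prop : Continuous fun t : ℝ => (volterraBound b₀ b₁ * K) • t ^ n)).integrableOn_Icc
      (a := 0) (b := 1)).mono_set Ioo_subset_Icc_self
  refine (norm_prim_le_prim (continuous_factor_inv_mul b₀ b₁
    (continuous_prim hi)).integrableOn_Ioo_zero_one hpow hx.1 ?_).trans ?_
  · filter_upwards [ae_restrict_mem measurableSet_Ioo] with t ht _
    rw [norm_mul]
    refine (mul_le_mul (norm_factor_inv_le b₀ b₁ t) (h1 t (Ioo_subset_Icc_self ht))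
      (norm_nonneg _) hM0.le).trans_eq ?_
    rw [volterraBound, smul_eq_mul]
    ring
  · rw [prim_smul, prim_eq_integral hx, integral_pow]
    simp
    apply le_of_eq
    ring

/-- The iterates of a Volterra operator decay factorially. -/
lemma norm_pow_volterra_apply_le (n : ℕ) (y : ℝ →ᵇ ℂ) {x : ℝ} (hx : x ∈ Icc (0 : ℝ) 1) :
    ‖((volterra b₀ b₁ ∘L toL2w b₀) ^ n) y x‖ ≤
      volterraBound b₀ b₁ ^ n * ‖y‖ / n.factorial * x ^ n := by
  induction n generalizing x with
  | zero => simpa using y.norm_coe_le_norm x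
  | succ n ih =>
    have hC := volterraBound_nonneg b₀ b₁
    rw [pow_succ']
    refine (norm_volterra_toL2w_le b₀ b₁ (by positivity) (fun t ht => ih ht) hx).trans_eq ?_
    rw [Nat.factorial_succ]
    push_cast
    field_simp
    ring

lemma norm_pow_succ_volterra_le (n : ℕ) : ‖(volterra b₀ b₁ ∘L toL2w b₀) ^ (n + 1)‖ ≤
    volterraBound b₀ b₁ ^ (n + 1) / (n + 1).factorial := by
  have hC := volterraBound_nonneg b₀ b₁
  refine ContinuousLinearMap.opNorm_le_bound _ (by positivity) fun y => ?_
  refine (norm_le (by positivity)).2 fun x => ?_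
  have hp : ((volterra b₀ b₁ ∘L toL2w b₀) ^ (n + 1)) y (projIcc (0 : ℝ) 1 zero_le_one x) =
      ((volterra b₀ b₁ ∘L toL2w b₀) ^ (n + 1)) y x := by
    rw [pow_succ', mul_apply_eq_comp, ContinuousLinearMap.comp_apply, volterra_apply,
      volterra_apply, prim_projIcc]
    exact (continuous_factor_inv_mul b₀ b₁ (continuous_prim
      (integrableOn_flux b₀ b₁ (integrable_coeFn _)))).integrableOn_Ioo_zero_one
  rw [← hp]
  refine (norm_pow_volterra_apply_le b₀ b₁ (n + 1) y (projIcc (0 : ℝ) 1 zero_le_one x).2).trans ?_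
  refine (mul_le_of_le_one_right (by positivity) (pow_le_one₀ ?_ ?_)).trans_eq (by ring)
  · exact (projIcc (0 : ℝ) 1 zero_le_one x).2.1
  · exact (projIcc (0 : ℝ) 1 zero_le_one x).2.2

lemma isUnit_one_sub_smul_volterra (z : ℂ) :
    IsUnit (1 - z • (volterra b₀ b₁ ∘L toL2w b₀)) := by
  have ht := (FloorSemiring.tendsto_pow_div_factorial_atTop
    (‖z‖ * volterraBound b₀ b₁)).comp (tendsto_add_atTop_nat 1)
  obtain ⟨n, hn⟩ := (ht.eventually (gt_mem_nhds one_pos)).exists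
  refine UnboundedOp.isUnit_one_sub_smul _ z (n := n + 1) (lt_of_le_of_lt ?_ hn)
  rw [Function.comp_apply, mul_pow, mul_div_assoc]
  gcongr
  exact norm_pow_succ_volterra_le b₀ b₁ n

end Operators

end JumpDiffusion

/-! ### Solutions of the differential equation -/

namespace JumpDiffusion

open BoundedContinuousFunction

section Solutions

lemma bcf_one_apply (x : ℝ) : (1 : ℝ →ᵇ ℂ) x = 1 := rfl

variable (b₀ : ℝ → ℝ) (b₁ : ℝ → ℂ) [hb : IsDrift b₀ b₁] [hw : IsWeight b₀]

/-- The solution `x ↦ ∫₀ˣ 1 / p` of the homogeneous equation with `y(0) = 0` and `y'(0) = 1`. -/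
def scaleFun : ℝ →ᵇ ℂ := primFactorInv b₀ b₁ 1

/-- The solution of `b₀ y'' + b₁ y' = g` with `y(0) = c₁` and `y'(0) = c₂`. -/
def sol (c₁ c₂ : ℂ) (g : L2w b₀) : ℝ →ᵇ ℂ := c₁ • 1 + c₂ • scaleFun b₀ b₁ + volterra b₀ b₁ g

/-- The derivative of `sol`. -/
def solDeriv (c₁ : ℂ) (g : L2w b₀) (x : ℝ) : ℂ :=
  (expPrim (drift b₀ b₁) x)⁻¹ * (c₁ - primFlux b₀ b₁ g x)

variable {b₀ b₁} {c₁ c₂ : ℂ} {g : L2w b₀}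

lemma continuous_solDeriv : Continuous (solDeriv b₀ b₁ c₂ g) :=
  continuous_factor_inv_mul b₀ b₁ (continuous_const.sub (primFlux b₀ b₁ g).continuous)

lemma sol_apply (x : ℝ) : sol b₀ b₁ c₁ c₂ g x = c₁ + prim (solDeriv b₀ b₁ c₂ g) x := by
  have h1 : solDeriv b₀ b₁ c₂ g = fun t => c₂ • ((expPrim (drift b₀ b₁) t)⁻¹ *
      (1 : ℝ →ᵇ ℂ) t) + -((expPrim (drift b₀ b₁) t)⁻¹ * primFlux b₀ b₁ g t) := by
    funext t
    simp only [solDeriv, bcf_one_apply, smul_eq_mul]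
    ring
  rw [h1, prim_add, prim_smul, prim_neg, ← primFactorInv_apply]
  · simp only [sol, BoundedContinuousFunction.add_apply, BoundedContinuousFunction.smul_apply,
      bcf_one_apply, smul_eq_mul, mul_one, scaleFun, volterra_apply,
      primFlux_apply]
    ring
  · exact Continuous.integrableOn_Ioo_zero_one
      ((continuous_factor_inv_mul b₀ b₁ (1 : ℝ →ᵇ ℂ).continuous).const_smul c₂)
  · exact Continuous.integrableOn_Ioo_zero_one
      (continuous_factor_inv_mul b₀ b₁ (primFlux b₀ b₁ g).continuous).neg

lemma sol_apply_zero : sol b₀ b₁ c₁ c₂ g 0 = c₁ := by simp [sol_apply]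

lemma solDeriv_zero : solDeriv b₀ b₁ c₂ g 0 = c₂ := by simp [solDeriv, primFlux_apply]

lemma hasACDeriv_sol : HasACDeriv (sol b₀ b₁ c₁ c₂ g) (solDeriv b₀ b₁ c₂ g) := by
  have hc : ∀ c : ℂ, AbsolutelyContinuousOnInterval (fun _ : ℝ => c) 0 1 := fun c =>
    (LipschitzWith.const c).lipschitzOnWith.absolutelyContinuousOnInterval
  refine ⟨?_, ?_, ?_⟩
  · have h1 : (sol b₀ b₁ c₁ c₂ g : ℝ → ℂ) = (fun _ => c₁) + prim (solDeriv b₀ b₁ c₂ g) :=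
      funext sol_apply
    rw [h1]
    exact (hc _).add (ac_prim continuous_solDeriv.integrableOn_Ioo_zero_one)
  · have h1 : solDeriv b₀ b₁ c₂ g = (expPrim fun t => -drift b₀ b₁ t) •
        ((fun _ => c₂) - prim (flux b₀ b₁ g)) := by
      funext x
      rw [Pi.smul_apply', expPrim_neg]
      rfl
    rw [h1]
    exact (ac_expPrim (integrableOn_drift b₀ b₁).neg).smul
      ((hc _).sub (ac_prim (integrableOn_flux b₀ b₁ (integrable_coeFn g))))
  · intro x hx
    have h1 : (sol b₀ b₁ c₁ c₂ g : ℝ → ℂ) = fun x => c₁ + prim (solDeriv b₀ b₁ c₂ g) x :=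
      funext sol_apply
    rw [h1]
    exact (hasDerivWithinAt_prim continuous_solDeriv hx).const_add c₁

lemma ae_hasDerivAt_solDeriv : ∀ᵐ x ∂volume.restrict (Ioo (0 : ℝ) 1),
    HasDerivAt (solDeriv b₀ b₁ c₂ g)
      (-(drift b₀ b₁ x * solDeriv b₀ b₁ c₂ g x + weight b₀ x * g x)) x := by
  filter_upwards [ae_hasDerivAt_expPrim (k := fun t => -drift b₀ b₁ t)
    (integrableOn_drift b₀ b₁).neg,
    ae_hasDerivAt_prim (integrableOn_flux b₀ b₁ (integrable_coeFn g))] with x h1 h2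
  have h3 : solDeriv b₀ b₁ c₂ g = fun x => expPrim (fun t => -drift b₀ b₁ t) x *
        (c₂ - prim (flux b₀ b₁ g) x) := by
      funext x
      rw [expPrim_neg]
      rfl
  rw [h3]
  refine (h1.mul (h2.const_sub c₂)).congr_deriv ?_
  have hp := expPrim_ne_zero (drift b₀ b₁) x
  simp only [flux, expPrim_neg]
  field_simp
  ring

omit hb in
lemma diffExpr_of_hasDerivAt {y' : ℝ → ℂ} {f : ℝ → ℂ}
    (h : ∀ᵐ x ∂volume.restrict (Ioo (0 : ℝ) 1),
      HasDerivAt y' (-(drift b₀ b₁ x * y' x + weight b₀ x * f x)) x) :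
    ∀ᵐ x ∂volume.restrict (Ioo (0 : ℝ) 1), diffExpr b₀ b₁ y' x = f x := by
  filter_upwards [h, hw.neg] with x hx hn
  have hn' : (b₀ x : ℂ) ≠ 0 := by exact_mod_cast hn.ne
  rw [diffExpr, hx.deriv, drift, weight]
  push_cast
  field_simp
  ring

lemma diffExpr_solDeriv : ∀ᵐ x ∂volume.restrict (Ioo (0 : ℝ) 1),
    diffExpr b₀ b₁ (solDeriv b₀ b₁ c₂ g) x = g x :=
  diffExpr_of_hasDerivAt ae_hasDerivAt_solDeriv

omit hb in
lemma _root_.AbsolutelyContinuousOnInterval.ae_differentiableAt_Ioo {f : ℝ → ℂ}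
    (hf : AbsolutelyContinuousOnInterval f 0 1) :
    ∀ᵐ x ∂volume.restrict (Ioo (0 : ℝ) 1), DifferentiableAt ℝ f x := by
  have hv : LocallyBoundedVariationOn f (Icc 0 1) := by
    have := hf.boundedVariationOn
    rw [uIcc_of_le zero_le_one] at this
    exact this.locallyBoundedVariationOn
  rw [ae_restrict_iff' measurableSet_Ioo]
  filter_upwards [hv.ae_differentiableWithinAt_of_mem] with x hx hx'
  exact (hx (Ioo_subset_Icc_self hx')).differentiableAt (Icc_mem_nhds hx'.1 hx'.2)

/-- Uniqueness for the initial value problem: multiplying the equation by the integrating factor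
`p` turns it into `(p y')' = -p w g`, which is integrated twice. -/
lemma HasACDeriv.eq_sol {y y' : ℝ → ℂ} (h : HasACDeriv y y')
    (hg : ∀ᵐ x ∂volume.restrict (Ioo (0 : ℝ) 1), diffExpr b₀ b₁ y' x = g x) {x : ℝ}
    (hx : x ∈ Icc (0 : ℝ) 1) : y x = sol b₀ b₁ (y 0) (y' 0) g x := by
  have hflux : IntegrableOn (fun t => -flux b₀ b₁ g t) (Ioo 0 1) :=
    (integrableOn_flux b₀ b₁ (integrable_coeFn g)).neg
  have h1 : ∀ x ∈ Icc (0 : ℝ) 1, y' x = solDeriv b₀ b₁ (y' 0) g x := by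
    intro x hx
    have h2 : (expPrim (drift b₀ b₁) • y') x = (expPrim (drift b₀ b₁) • y') 0 +
        prim (fun t => -flux b₀ b₁ g t) x := by
      refine eq_add_prim ((ac_expPrim (integrableOn_drift b₀ b₁)).smul h.ac') hflux ?_ hx
      filter_upwards [ae_hasDerivAt_expPrim (integrableOn_drift b₀ b₁),
        h.ac'.ae_differentiableAt_Ioo, hg, hw.neg] with t h3 h4 h5 h6
      have h6' : (b₀ t : ℂ) ≠ 0 := by exact_mod_cast h6.ne
      refine (h3.mul h4.hasDerivAt).congr_deriv ?_
      simp only [flux, ← h5, diffExpr, drift, weight]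
      push_cast
      field_simp
      ring
    rw [Pi.smul_apply', Pi.smul_apply', expPrim_zero, one_smul, prim_neg, smul_eq_mul] at h2
    rw [solDeriv, primFlux_apply, eq_inv_mul_iff_mul_eq₀ (expPrim_ne_zero _ _), h2]
    ring
  rw [sol_apply]
  refine eq_add_prim h.ac continuous_solDeriv.integrableOn_Ioo_zero_one ?_ hx
  filter_upwards [ae_restrict_mem measurableSet_Ioo] with t ht
  rw [← h1 t (Ioo_subset_Icc_self ht)]
  exact (h.hasDeriv t (Ioo_subset_Icc_self ht)).hasDerivAt (Icc_mem_nhds ht.1 ht.2)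

/-- The boundary functional `y ↦ y(a) - ∫ y dν`. -/
def boundaryFun (a : ℝ) (ν : Measure (Ioo (0 : ℝ) 1)) [IsFiniteMeasure ν] : (ℝ →ᵇ ℂ) →L[ℂ] ℂ :=
  evalCLM ℂ a - LinearMap.mkContinuous
    { toFun := fun y : ℝ →ᵇ ℂ => ∫ t : Ioo (0 : ℝ) 1, y t ∂ν
      map_add' := fun y u => by
        have hi : ∀ y : ℝ →ᵇ ℂ, Integrable (fun t : Ioo (0 : ℝ) 1 => y t) ν := fun y =>
          Integrable.of_bound (y.continuous.comp continuous_subtype_val).aestronglyMeasurable ‖y‖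
            (ae_of_all _ fun t => y.norm_coe_le_norm t)
        exact integral_add (hi y) (hi u)
      map_smul' := fun c y => integral_const_mul c _ } (ν.real univ) fun y => by
    rw [mul_comm]
    exact norm_integral_le_of_norm_le_const (ae_of_all ν fun t => y.norm_coe_le_norm t)

omit hb hw in
lemma boundaryFun_apply (a : ℝ) (ν : Measure (Ioo (0 : ℝ) 1)) [IsFiniteMeasure ν] (y : ℝ →ᵇ ℂ) :
    boundaryFun a ν y = y a - ∫ t, y t ∂ν := rfl

omit hb hw in
lemma boundaryFun_eq_zero_iff {a : ℝ} {ν : Measure (Ioo (0 : ℝ) 1)} [IsFiniteMeasure ν]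
    {y : ℝ →ᵇ ℂ} : boundaryFun a ν y = 0 ↔ y a = ∫ t, y t ∂ν := by
  rw [boundaryFun_apply, sub_eq_zero]

variable (b₀ b₁) (ν₀ ν₁ : Measure (Ioo (0 : ℝ) 1)) [IsFiniteMeasure ν₀] [IsFiniteMeasure ν₁]

lemma mem_graph_jumpOperator {f g : L2w b₀} :
    (f, g) ∈ (jumpOperator b₀ b₁ ν₀ ν₁).graph ↔ ∃ c₁ c₂ : ℂ, ∃ y : ℝ →ᵇ ℂ,
      y = sol b₀ b₁ c₁ c₂ g ∧ toL2w b₀ y = f ∧ boundaryFun 0 ν₀ y = 0 ∧ boundaryFun 1 ν₁ y = 0 := by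
  rw [graph_jumpOperator b₁ hw.neg hw.integrableOn]
  constructor
  · rintro ⟨y, y', h, h1, h2, h3, h4⟩
    have hy := fun x (hx : x ∈ Icc (0 : ℝ) 1) =>
      h.eq_sol (g := g) ((ae_wMeasure_iff.1 h2).mono fun t ht => ht.symm) hx
    have hint : ∀ ν : Measure (Ioo (0 : ℝ) 1), ∫ t, y t ∂ν =
        ∫ t, sol b₀ b₁ (y 0) (y' 0) g t ∂ν := fun ν =>
      integral_congr_ae (ae_of_all _ fun t => hy t (Ioo_subset_Icc_self t.2))
    refine ⟨y 0, y' 0, _, rfl, ?_, ?_, ?_⟩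
    · refine Lp.ext ((coeFn_toL2w b₀ _).trans (EventuallyEq.trans ?_ h1.symm))
      refine ae_wMeasure_iff.2 ?_
      filter_upwards [ae_restrict_mem measurableSet_Ioo] with t ht
      exact (hy t (Ioo_subset_Icc_self ht)).symm
    · rw [boundaryFun_eq_zero_iff, ← hint, ← hy 0 (by simp), h3]
    · rw [boundaryFun_eq_zero_iff, ← hint, ← hy 1 (by simp), h4]
  · rintro ⟨c₁, c₂, y, rfl, rfl, h1, h2⟩
    rw [boundaryFun_eq_zero_iff] at h1 h2
    exact ⟨sol b₀ b₁ c₁ c₂ g, solDeriv b₀ b₁ c₂ g, hasACDeriv_sol, coeFn_toL2w b₀ _,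
      ae_wMeasure_iff.2 (diffExpr_solDeriv.mono fun t ht => ht.symm), h1, h2⟩

lemma isBoundaryProblem : UnboundedOp.IsBoundaryProblem (jumpOperator b₀ b₁ ν₀ ν₁)
    (volterra b₀ b₁) (toL2w b₀) 1 (scaleFun b₀ b₁) (boundaryFun 0 ν₀) (boundaryFun 1 ν₁) where
  mem_graph f g := mem_graph_jumpOperator b₀ b₁ ν₀ ν₁
  isUnit := isUnit_one_sub_smul_volterra b₀ b₁
  compact := isCompactOperator_toL2w_comp_volterra b₀ b₁
  indep c₁ c₂ h := by
    have h1 : (sol b₀ b₁ c₁ c₂ 0 : ℝ → ℂ) =ᵐ[volume.restrict (Ioo (0 : ℝ) 1)] fun _ => 0 := by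
      refine (ae_wMeasure_iff (b₀ := b₀)).1 ?_
      have h2 : toL2w b₀ (sol b₀ b₁ c₁ c₂ 0) = 0 := by rw [sol, map_zero, add_zero, h]
      have h3 := coeFn_toL2w b₀ (sol b₀ b₁ c₁ c₂ 0)
      rw [h2] at h3
      exact h3.symm.trans (Lp.coeFn_zero _ _ _)
    have h2 := Measure.eqOn_open_of_ae_eq h1 isOpen_Ioo
      (sol b₀ b₁ c₁ c₂ 0).continuous.continuousOn continuousOn_const
    have hm : (1 / 2 : ℝ) ∈ Ioo (0 : ℝ) 1 := by norm_num
    have h3 : HasDerivAt (sol b₀ b₁ c₁ c₂ 0) (solDeriv b₀ b₁ c₂ 0 (1 / 2)) (1 / 2) :=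
      (hasACDeriv_sol.hasDeriv _ (Ioo_subset_Icc_self hm)).hasDerivAt (Icc_mem_nhds hm.1 hm.2)
    have h4 : solDeriv b₀ b₁ c₂ 0 (1 / 2) = 0 :=
      h3.unique ((hasDerivAt_const _ (0 : ℂ)).congr_of_eventuallyEq
        (h2.eventuallyEq_of_mem (isOpen_Ioo.mem_nhds hm)))
    have hc₂ : c₂ = 0 := by simpa [solDeriv, expPrim_ne_zero] using h4
    subst hc₂
    have h5 := h2 hm
    simp only [sol, zero_smul, map_zero, add_zero, BoundedContinuousFunction.smul_apply,
      bcf_one_apply, smul_eq_mul, mul_one] at h5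
    exact ⟨h5, rfl⟩

/-- The solution of `b₀ y'' + b₁ y' = z y` with initial data `y(0) = c₁` and `y'(0) = c₂`. -/
def eigenSol (z c₁ c₂ : ℂ) : ℝ →ᵇ ℂ :=
  UnboundedOp.solOp (volterra b₀ b₁) (toL2w b₀) z (c₁ • 1 + c₂ • scaleFun b₀ b₁)

variable {b₀ b₁} {z : ℂ}

lemma eigenSol_eq_sol :
    eigenSol b₀ b₁ z c₁ c₂ = sol b₀ b₁ c₁ c₂ (z • toL2w b₀ (eigenSol b₀ b₁ z c₁ c₂)) := by
  have := ((isBoundaryProblem b₀ b₁ 0 0).eq_solOp_iff (z := z)).1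
    (rfl : eigenSol b₀ b₁ z c₁ c₂ = _)
  rw [sol, map_smul]
  exact this

lemma eigenSol_eq_add :
    eigenSol b₀ b₁ z c₁ c₂ = c₁ • eigenSol b₀ b₁ z 1 0 + c₂ • eigenSol b₀ b₁ z 0 1 := by
  simp [eigenSol]

lemma isSolution_eigenSol : IsSolution b₀ b₁ z (eigenSol b₀ b₁ z c₁ c₂)
    (solDeriv b₀ b₁ c₂ (z • toL2w b₀ (eigenSol b₀ b₁ z c₁ c₂))) := by
  constructor
  · nth_rewrite 1 [eigenSol_eq_sol]
    exact hasACDeriv_sol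
  · filter_upwards [diffExpr_solDeriv (b₁ := b₁) (c₂ := c₂)
      (g := z • toL2w b₀ (eigenSol b₀ b₁ z c₁ c₂)), ae_wMeasure_iff.1 (Lp.coeFn_smul z
      (toL2w b₀ (eigenSol b₀ b₁ z c₁ c₂))), ae_wMeasure_iff.1 (coeFn_toL2w b₀
      (eigenSol b₀ b₁ z c₁ c₂))] with x h1 h2 h3
    rw [h1, h2, Pi.smul_apply, h3, smul_eq_mul]

lemma eigenSol_apply_zero : eigenSol b₀ b₁ z c₁ c₂ 0 = c₁ := by
  rw [eigenSol_eq_sol, sol_apply_zero]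

lemma isFundamentalPair_eigenSol :
    IsFundamentalPair b₀ b₁ z (eigenSol b₀ b₁ z 1 0) (eigenSol b₀ b₁ z 0 1) :=
  ⟨_, _, isSolution_eigenSol, isSolution_eigenSol, eigenSol_apply_zero, solDeriv_zero,
    eigenSol_apply_zero, solDeriv_zero⟩

lemma charFun_eq_charDet :
    UnboundedOp.charFun (volterra b₀ b₁) (toL2w b₀) 1 (scaleFun b₀ b₁) (boundaryFun 0 ν₀)
      (boundaryFun 1 ν₁) z = charDet ν₀ ν₁ (eigenSol b₀ b₁ z 1 0) (eigenSol b₀ b₁ z 0 1) := by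
  have h1 : UnboundedOp.solOp (volterra b₀ b₁) (toL2w b₀) z 1 = eigenSol b₀ b₁ z 1 0 := by
    simp [eigenSol]
  have h2 : UnboundedOp.solOp (volterra b₀ b₁) (toL2w b₀) z (scaleFun b₀ b₁) =
      eigenSol b₀ b₁ z 0 1 := by
    simp [eigenSol]
  rw [UnboundedOp.charFun, h1, h2, charDet, Matrix.det_fin_two_of]
  simp only [boundaryFun_apply, eigenSol_apply_zero]
  ring

end Solutions

end JumpDiffusion

/-! ### Energy estimates for large negative spectral parameter -/

namespace JumpDiffusion

open BoundedContinuousFunction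

section LargeParameter

lemma integrableOn_mul_of_continuousOn {𝕜 : Type*} [RCLike 𝕜] {f k : ℝ → 𝕜}
    (hk : IntegrableOn k (Ioo 0 1)) (hf : ContinuousOn f (Icc 0 1)) :
    IntegrableOn (fun t => k t * f t) (Ioo 0 1) := by
  rw [← integrableOn_Icc_iff_integrableOn_Ioo] at hk ⊢
  exact hk.mul_continuousOn hf isCompact_Icc

variable {b₀ : ℝ → ℝ} {b₁ : ℝ → ℂ} {y y' : ℝ → ℂ} {s : ℝ}

/-- The drift is the sum of a part that is dominated by the square root of the weight and a part
with small integral. -/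
lemma exists_drift_split (b₀ : ℝ → ℝ) (b₁ : ℝ → ℂ) [hb : IsDrift b₀ b₁] [hw : IsWeight b₀] {ε : ℝ}
    (hε : 0 < ε) : ∃ C : ℝ, ∃ k : ℝ → ℂ, IntegrableOn k (Ioo 0 1) ∧
      ∫ t in Ioo (0 : ℝ) 1, ‖k t‖ ≤ ε ∧ ∀ᵐ t ∂volume.restrict (Ioo (0 : ℝ) 1),
        ‖drift b₀ b₁ t - k t‖ ≤ C * √(weight b₀ t) := by
  -- a soft cutoff at `|b₁ / b₀| = n √w`; it tends to zero pointwise because `w > 0` a.e.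
  let k : ℕ → ℝ → ℂ := fun n t =>
    ((‖drift b₀ b₁ t‖ / (‖drift b₀ b₁ t‖ + n * √(weight b₀ t)) : ℝ) : ℂ) * drift b₀ b₁ t
  have hd := integrableOn_drift b₀ b₁
  have hle : ∀ n t, ‖k n t‖ ≤ ‖drift b₀ b₁ t‖ := fun n t => by
    rw [norm_mul, Complex.norm_real, Real.norm_of_nonneg (by positivity)]
    refine mul_le_of_le_one_left (norm_nonneg _) (div_le_one_of_le₀ ?_ (by positivity))
    exact le_add_of_nonneg_right (by positivity)
  have hmeas : ∀ n, AEStronglyMeasurable (k n) (volume.restrict (Ioo 0 1)) := by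
    intro n
    have h1 : AEMeasurable (drift b₀ b₁) (volume.restrict (Ioo 0 1)) :=
      hd.aestronglyMeasurable.aemeasurable
    have h2 : AEMeasurable (weight b₀) (volume.restrict (Ioo 0 1)) :=
      (integrableOn_weight b₀).aestronglyMeasurable.aemeasurable
    exact ((Complex.measurable_ofReal.comp_aemeasurable
      (h1.norm.div (h1.norm.add (h2.sqrt.const_mul _)))).mul h1).aestronglyMeasurable
  have hlim : Tendsto (fun n => ∫ t in Ioo (0 : ℝ) 1, ‖k n t‖) atTop
      (𝓝 (∫ t in Ioo (0 : ℝ) 1, (0 : ℝ))) := by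
    refine tendsto_integral_of_dominated_convergence _ (fun n => (hmeas n).norm) hd.norm
      (fun n => ae_of_all _ fun t => by simpa using hle n t) ?_
    filter_upwards [ae_weight_pos b₀] with t ht
    have h1 : Tendsto (fun n : ℕ => ‖drift b₀ b₁ t‖ + n * √(weight b₀ t)) atTop atTop :=
      tendsto_atTop_add_const_left _ _
        (tendsto_natCast_atTop_atTop.atTop_mul_const (Real.sqrt_pos.2 ht))
    have h2 := (h1.const_div_atTop ‖drift b₀ b₁ t‖).mul_const ‖drift b₀ b₁ t‖
    rw [zero_mul] at h2
    refine h2.congr fun n => ?_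
    rw [norm_mul, Complex.norm_real, Real.norm_of_nonneg (by positivity)]
  rw [integral_zero] at hlim
  obtain ⟨n, hn⟩ := (hlim.eventually (ge_mem_nhds hε)).exists
  refine ⟨n, k n, Integrable.mono hd (hmeas n) (ae_of_all _ (hle n)), hn, ?_⟩
  filter_upwards [ae_weight_pos b₀] with t ht
  have hq : 0 < √(weight b₀ t) := Real.sqrt_pos.2 ht
  rcases eq_or_ne (‖drift b₀ b₁ t‖ + n * √(weight b₀ t)) 0 with h0 | h0
  · have h1 : ‖drift b₀ b₁ t‖ = 0 :=
      le_antisymm (by rw [← h0]; exact le_add_of_nonneg_right (by positivity)) (norm_nonneg _)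
    rw [norm_eq_zero] at h1
    simp only [k, h1, mul_zero, sub_zero, norm_zero]
    positivity
  · have h1 : drift b₀ b₁ t - k n t =
        ((n * √(weight b₀ t) / (‖drift b₀ b₁ t‖ + n * √(weight b₀ t)) : ℝ) : ℂ) *
          drift b₀ b₁ t := by
      have h2 : (n * √(weight b₀ t) / (‖drift b₀ b₁ t‖ + n * √(weight b₀ t)) : ℝ) =
          1 - ‖drift b₀ b₁ t‖ / (‖drift b₀ b₁ t‖ + n * √(weight b₀ t)) := by
        field_simp
        ring
      rw [h2]
      simp only [k]
      push_cast
      ring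
    have hpos : 0 < ‖drift b₀ b₁ t‖ + n * √(weight b₀ t) := lt_of_le_of_ne (by positivity) h0.symm
    rw [h1, norm_mul, Complex.norm_real, Real.norm_of_nonneg (by positivity), div_mul_eq_mul_div,
      div_le_iff₀ hpos]
    gcongr
    exact le_add_of_nonneg_right (by positivity)

/-- The energy density `|y'|² + s w |y|²`. -/
def energy (b₀ : ℝ → ℝ) (s : ℝ) (y y' : ℝ → ℂ) (t : ℝ) : ℝ :=
  ‖y' t‖ ^ 2 + weight b₀ t * (s * ‖y t‖ ^ 2)

lemma HasACDeriv.continuousOn (h : HasACDeriv y y') : ContinuousOn y (Icc 0 1) := by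
  simpa [uIcc_of_le zero_le_one] using h.ac.continuousOn

lemma HasACDeriv.continuousOn' (h : HasACDeriv y y') : ContinuousOn y' (Icc 0 1) := by
  simpa [uIcc_of_le zero_le_one] using h.ac'.continuousOn

lemma HasACDeriv.ae_hasDerivAt (h : HasACDeriv y y') :
    ∀ᵐ x ∂volume.restrict (Ioo (0 : ℝ) 1), HasDerivAt y (y' x) x := by
  filter_upwards [ae_restrict_mem measurableSet_Ioo] with t ht
  exact (h.hasDeriv t (Ioo_subset_Icc_self ht)).hasDerivAt (Icc_mem_nhds ht.1 ht.2)

variable [hw : IsWeight b₀]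

lemma integrableOn_energy (h : HasACDeriv y y') : IntegrableOn (energy b₀ s y y') (Ioo 0 1) := by
  refine Integrable.add ?_ ?_
  · exact ((h.continuousOn'.norm.pow 2).integrableOn_Icc).mono_set Ioo_subset_Icc_self
  · exact integrableOn_mul_of_continuousOn (𝕜 := ℝ) (integrableOn_weight b₀)
      (continuousOn_const.mul (h.continuousOn.norm.pow 2))

lemma ae_energy_nonneg (hs : 0 ≤ s) :
    ∀ᵐ t ∂volume.restrict (Ioo (0 : ℝ) 1), 0 ≤ energy b₀ s y y' t := by
  filter_upwards [ae_weight_pos b₀] with t ht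
  unfold energy
  positivity

lemma monotone_prim_energy (h : HasACDeriv y y') (hs : 0 ≤ s) :
    Monotone (prim (energy b₀ s y y')) :=
  prim_mono (integrableOn_energy h) (ae_energy_nonneg hs)

lemma IsSolution.ae_hasDerivAt {z : ℂ} (h : IsSolution b₀ b₁ z y y') :
    ∀ᵐ x ∂volume.restrict (Ioo (0 : ℝ) 1),
      HasDerivAt y' (-(drift b₀ b₁ x * y' x + weight b₀ x * (z * y x))) x := by
  filter_upwards [h.eqn, h.hasACDeriv.ac'.ae_differentiableAt_Ioo, hw.neg] with x h1 h2 h3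
  have h3' : (b₀ x : ℂ) ≠ 0 := by exact_mod_cast h3.ne
  refine h2.hasDerivAt.congr_deriv ?_
  rw [← h1, diffExpr, drift, weight]
  push_cast
  field_simp
  ring

variable [hb : IsDrift b₀ b₁]

/-- The derivative of `exp (∫ k) y' ȳ` is close to the energy density, if `k` carries most of the
drift where the latter is large in comparison with the square root of the weight. -/
lemma norm_increment_sub_energy_le {C : ℝ} {k : ℝ → ℂ}
    (hk : IntegrableOn k (Ioo 0 1)) (hε : ∫ t in Ioo (0 : ℝ) 1, ‖k t‖ ≤ 1 / 16)
    (hC : ∀ᵐ t ∂volume.restrict (Ioo (0 : ℝ) 1), ‖drift b₀ b₁ t - k t‖ ≤ C * √(weight b₀ t))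
    (hs : 5 * C ≤ √s) (hs0 : 0 < s) (h : IsSolution b₀ b₁ (-s) y y') {a b : ℝ} (ha : 0 ≤ a)
    (hab : a ≤ b) (hb1 : b ≤ 1) :
    ‖expPrim k b * (y' b * star (y b)) - expPrim k a * (y' a * star (y a)) -
      ((prim (energy b₀ s y y') b - prim (energy b₀ s y y') a : ℝ) : ℂ)‖ ≤
      1 / 4 * (prim (energy b₀ s y y') b - prim (energy b₀ s y y') a) := by
  set G := energy b₀ s y y' with hG
  have hGi : IntegrableOn G (Ioo 0 1) := integrableOn_energy h.hasACDeriv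
  have hGc : IntegrableOn (fun t => (G t : ℂ)) (Ioo 0 1) := hGi.ofReal
  have hstar : AbsolutelyContinuousOnInterval (fun t => star (y t)) 0 1 :=
    h.hasACDeriv.ac.of_dist_le (C := 1) fun x _ t _ => by
      rw [one_mul, dist_eq_norm, ← star_sub, norm_star, dist_eq_norm]
  let K : ℝ → ℂ := fun t => ((G t : ℂ) - (drift b₀ b₁ t - k t) * (y' t * star (y t))) * expPrim k t
  have hK : IntegrableOn K (Ioo 0 1) := by
    refine integrableOn_mul_of_continuousOn (hGc.sub ?_) (continuous_expPrim hk).continuousOn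
    exact integrableOn_mul_of_continuousOn ((integrableOn_drift b₀ b₁).sub hk)
      (h.hasACDeriv.continuousOn'.mul h.hasACDeriv.continuousOn.star)
  have hZ : ∀ x ∈ Icc (0 : ℝ) 1, expPrim k x * (y' x * star (y x)) =
      expPrim k 0 * (y' 0 * star (y 0)) + prim K x := by
    intro x hx
    refine eq_add_prim (g := fun x => expPrim k x * (y' x * star (y x)))
      ((ac_expPrim hk).smul (h.hasACDeriv.ac'.smul hstar)) hK ?_ hx
    filter_upwards [ae_hasDerivAt_expPrim hk, h.ae_hasDerivAt, h.hasACDeriv.ae_hasDerivAt]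
      with t h1 h2 h3
    refine (h1.mul (h2.mul h3.star)).congr_deriv ?_
    have e1 : ((‖y t‖ : ℂ)) ^ 2 = y t * star (y t) := (Complex.mul_conj' (y t)).symm
    have e2 : ((‖y' t‖ : ℂ)) ^ 2 = y' t * star (y' t) := (Complex.mul_conj' (y' t)).symm
    simp only [K, hG, energy, Pi.mul_apply]
    push_cast
    rw [e1, e2]
    ring
  have hpc : ∀ x, prim (fun t => (G t : ℂ)) x = ((prim G x : ℝ) : ℂ) := fun x => by
    rw [prim, prim, ← intervalIntegral.integral_ofReal]
    congr 1
    funext t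
    by_cases ht : t ∈ Ioo (0 : ℝ) 1
    · simp only [indicator_of_mem ht]
    · simp only [indicator_of_notMem ht, Complex.ofReal_zero]
  have hsum := fun x => prim_add (k := fun t => K t - G t) (hK.sub hGc) hGc x
  simp only [sub_add_cancel] at hsum
  rw [hZ b ⟨ha.trans hab, hb1⟩, hZ a ⟨ha, hab.trans hb1⟩, hsum, hsum, hpc, hpc]
  have hmain := norm_prim_sub_le (k := fun t => K t - G t) (m := fun t => (1 / 4 : ℝ) • G t)
    (hK.sub hGc) (Integrable.smul (1 / 4 : ℝ) hGi) hab ?_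
  · rw [prim_smul, prim_smul, ← smul_sub, smul_eq_mul] at hmain
    refine le_trans (le_of_eq ?_) hmain
    congr 1
    push_cast
    ring
  filter_upwards [hC, ae_weight_pos b₀, ae_energy_nonneg (b₀ := b₀) (y := y) (y' := y') hs0.le]
    with t h1 h2 h3 _ _
  rw [← hG] at h3
  have hu : ‖prim k t‖ ≤ 1 / 16 := (norm_prim_le hk t).trans hε
  have hp1 : ‖expPrim k t - 1‖ ≤ 1 / 8 :=
    (Complex.norm_exp_sub_one_le (hu.trans (by norm_num))).trans (by linarith)
  have hp2 : ‖expPrim k t‖ ≤ 9 / 8 := by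
    calc ‖expPrim k t‖ = ‖(expPrim k t - 1) + 1‖ := by rw [sub_add_cancel]
      _ ≤ ‖expPrim k t - 1‖ + ‖(1 : ℂ)‖ := norm_add_le _ _
      _ ≤ 9 / 8 := by rw [norm_one]; linarith
  -- by the inequality of arithmetic and geometric means, with `C √w ≤ √(s w) / 5`
  have hd : ‖(drift b₀ b₁ t - k t) * (y' t * star (y t))‖ ≤ 1 / 10 * G t := by
    rw [norm_mul, norm_mul, norm_star]
    have h4 : C * √(weight b₀ t) ≤ 1 / 5 * (√s * √(weight b₀ t)) := by
      have := Real.sqrt_nonneg (weight b₀ t)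
      nlinarith
    have h5 : (√s * √(weight b₀ t) * ‖y t‖) ^ 2 = weight b₀ t * (s * ‖y t‖ ^ 2) := by
      rw [mul_pow, mul_pow, Real.sq_sqrt hs0.le, Real.sq_sqrt h2.le]
      ring
    calc _ ≤ 1 / 5 * (√s * √(weight b₀ t)) * (‖y' t‖ * ‖y t‖) := by
          gcongr
          exact h1.trans h4
      _ ≤ 1 / 10 * (‖y' t‖ ^ 2 + (√s * √(weight b₀ t) * ‖y t‖) ^ 2) := by
          nlinarith [sq_nonneg (‖y' t‖ - √s * √(weight b₀ t) * ‖y t‖)]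
      _ = _ := by rw [h5, hG, energy]
  have he : K t - G t = (expPrim k t - 1) * G t -
      expPrim k t * ((drift b₀ b₁ t - k t) * (y' t * star (y t))) := by
    simp only [K]
    ring
  rw [he, smul_eq_mul]
  refine (norm_sub_le _ _).trans ?_
  rw [norm_mul, norm_mul _ ((drift b₀ b₁ t - k t) * _), Complex.norm_real, Real.norm_of_nonneg h3]
  calc _ ≤ 1 / 8 * G t + 9 / 8 * (1 / 10 * G t) := by gcongr
    _ ≤ 1 / 4 * G t := by linarith

/-- If the spectral parameter `-s` is large, then `Re (y' ȳ)` controls the energy of a solution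
that vanishes at an endpoint. -/
lemma exists_forall_energy_le (b₀ : ℝ → ℝ) (b₁ : ℝ → ℂ) [hw : IsWeight b₀] [hb : IsDrift b₀ b₁] :
    ∃ S : ℝ, 0 < S ∧ ∀ s, S ≤ s → ∀ y y' : ℝ → ℂ,
      IsSolution b₀ b₁ (-s) y y' → ∀ x ∈ Icc (0 : ℝ) 1,
      (y 1 = 0 → (y' x * star (y x)).re ≤
        -(1 / 2 * (prim (energy b₀ s y y') 1 - prim (energy b₀ s y y') x))) ∧
      (y 0 = 0 → 1 / 2 * prim (energy b₀ s y y') x ≤ (y' x * star (y x)).re) := by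
  obtain ⟨C, k, hk, hε, hC⟩ := exists_drift_split b₀ b₁ (ε := 1 / 16) (by norm_num)
  -- the summand one only makes the threshold positive if `C = 0`
  refine ⟨(5 * C) ^ 2 + 1, by positivity, fun s hs y y' h x hx => ?_⟩
  have hs0 : 0 < s := lt_of_lt_of_le (by positivity) hs
  have hs' : 5 * C ≤ √s := Real.le_sqrt_of_sq_le (by linarith)
  have hmono := monotone_prim_energy (b₀ := b₀) h.hasACDeriv hs0.le
  have key := @norm_increment_sub_energy_le b₀ b₁ y y' s hw hb C k hk hε hC hs' hs0 h
  have hu : ‖prim k x‖ ≤ 1 / 16 := (norm_prim_le hk x).trans hε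
  have hp1 : ‖(expPrim k x)⁻¹ - 1‖ ≤ 1 / 8 := by
    rw [expPrim, ← Complex.exp_neg]
    refine (Complex.norm_exp_sub_one_le ?_).trans ?_ <;> rw [norm_neg] <;> linarith
  have hp2 : ‖(expPrim k x)⁻¹‖ ≤ 9 / 8 := by
    calc ‖(expPrim k x)⁻¹‖ = ‖((expPrim k x)⁻¹ - 1) + 1‖ := by rw [sub_add_cancel]
      _ ≤ ‖(expPrim k x)⁻¹ - 1‖ + ‖(1 : ℂ)‖ := norm_add_le _ _
      _ ≤ 9 / 8 := by rw [norm_one]; linarith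
  have hp0 := expPrim_ne_zero k x
  -- an estimate for `exp (∫ k) y' ȳ` gives one for `y' ȳ`, as the first factor is close to one
  have hfin : ∀ Z : ℂ, ∀ r : ℝ, 0 ≤ r → ‖expPrim k x * Z - r‖ ≤ 1 / 4 * r →
      |Z.re - r| ≤ 1 / 2 * r := by
    intro Z r hr hZ
    have e : Z - r = (expPrim k x)⁻¹ * (expPrim k x * Z - r) + ((expPrim k x)⁻¹ - 1) * r := by
      field_simp
      ring
    have h1 : ‖Z - r‖ ≤ 9 / 8 * (1 / 4 * r) + 1 / 8 * r := by
      rw [e]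
      refine (norm_add_le _ _).trans ?_
      rw [norm_mul, norm_mul, Complex.norm_real, Real.norm_of_nonneg hr]
      gcongr
    have h2 := Complex.abs_re_le_norm (Z - r)
    rw [Complex.sub_re, Complex.ofReal_re] at h2
    linarith
  constructor
  · intro hy
    have h1 := key hx.1 hx.2 le_rfl
    rw [hy, star_zero, mul_zero, mul_zero, zero_sub, ← mul_neg] at h1
    have h2 := hfin _ _ (sub_nonneg.2 (hmono hx.2)) h1
    rw [Complex.neg_re] at h2
    have h3 := abs_le.1 h2
    linarith [h3.1]
  · intro hy
    have h1 := key le_rfl hx.1 hx.2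
    rw [hy, star_zero, mul_zero, mul_zero, sub_zero, prim_zero, sub_zero] at h1
    have h0 : 0 ≤ prim (energy b₀ s y y') x := by
      simpa using hmono hx.1
    have h3 := abs_le.1 (hfin _ _ h0 h1)
    linarith [h3.2]

end LargeParameter

end JumpDiffusion

/-! ### The resolvent set is not empty -/

namespace JumpDiffusion

open BoundedContinuousFunction

section Decay

variable {b₀ : ℝ → ℝ} {b₁ : ℝ → ℂ} {y y' : ℝ → ℂ} {s : ℝ}

lemma prim_weight_lt (b₀ : ℝ → ℝ) [IsWeight b₀] {a b : ℝ} (ha : 0 ≤ a) (hab : a < b)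
    (hb : b ≤ 1) : prim (weight b₀) a < prim (weight b₀) b := by
  rw [← sub_pos, prim_sub_prim (integrableOn_weight b₀)]
  have hw := ae_weight_pos b₀
  rw [ae_restrict_iff' measurableSet_Ioo] at hw
  refine (intervalIntegral.integral_pos_iff_support_of_nonneg_ae ?_
    (intervalIntegrable_indicator (integrableOn_weight b₀) a b)).2 ⟨hab, ?_⟩
  · filter_upwards [hw] with t ht
    by_cases hI : t ∈ Ioo (0 : ℝ) 1
    · rw [indicator_of_mem hI]
      exact (ht hI).le
    · rw [indicator_of_notMem hI]
      exact le_rfl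
  · refine lt_of_lt_of_le (b := volume (Ioo a b)) (by simpa using hab) (measure_mono_ae ?_)
    filter_upwards [hw] with t ht htI
    have hI : t ∈ Ioo (0 : ℝ) 1 := ⟨ha.trans_lt htI.1, htI.2.trans_le hb⟩
    refine ⟨?_, Ioo_subset_Ioc_self htI⟩
    rw [Function.mem_support, indicator_of_mem hI]
    exact (ht hI).ne'

lemma HasACDeriv.exists_normSq_sub_eq (h : HasACDeriv y y') {a b : ℝ} (ha : 0 ≤ a) (hab : a < b)
    (hb : b ≤ 1) : ∃ t ∈ Ioo a b,
      ‖y b‖ ^ 2 - ‖y a‖ ^ 2 = 2 * (y' t * star (y t)).re * (b - a) := by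
  obtain ⟨t, ht, he⟩ := exists_hasDerivAt_eq_slope (fun x => ‖y x‖ ^ 2)
    (fun x => 2 * (y' x * star (y x)).re) hab
    ((h.continuousOn.mono (Icc_subset_Icc ha hb)).norm.pow 2) fun x hx => by
      have hd : HasDerivAt y (y' x) x :=
        (h.hasDeriv x ⟨ha.trans hx.1.le, hx.2.le.trans hb⟩).hasDerivAt
          (Icc_mem_nhds (ha.trans_lt hx.1) (hx.2.trans_le hb))
      refine hd.norm_sq.congr_deriv ?_
      rw [Complex.inner]
      rfl
  refine ⟨t, ht, ?_⟩
  rw [he, div_mul_cancel₀ _ (sub_pos.2 hab).ne']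

variable [hw : IsWeight b₀]

/-- On an interval where a solution is bounded below its energy is at least of the order of the
spectral parameter. -/
lemma mul_prim_weight_sub_le (h : HasACDeriv y y') (hs : 0 ≤ s) {a b c : ℝ}
    (hab : a ≤ b) (hc0 : 0 ≤ c) (hc : ∀ t ∈ Icc a b, c ≤ ‖y t‖ ^ 2) :
    s * c * (prim (weight b₀) b - prim (weight b₀) a) ≤
      prim (energy b₀ s y y') b - prim (energy b₀ s y y') a := by
  have h1 := norm_prim_sub_le (k := fun t => (s * c) • weight b₀ t)
    (Integrable.smul (s * c) (integrableOn_weight b₀)) (integrableOn_energy (s := s) (b₀ := b₀) h)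
    hab ?_
  · rw [prim_smul, prim_smul, ← smul_sub, smul_eq_mul] at h1
    exact (le_abs_self _).trans h1
  filter_upwards [ae_weight_pos b₀] with t ht hat htb
  rw [smul_eq_mul, Real.norm_of_nonneg (by positivity), energy]
  have h2 := hc t ⟨hat.le, htb⟩
  calc s * c * weight b₀ t = weight b₀ t * (s * c) := by ring
    _ ≤ weight b₀ t * (s * ‖y t‖ ^ 2) := by gcongr
    _ ≤ _ := le_add_of_nonneg_left (by positivity)

/-- For large `s`, a solution of `b₀ y'' + b₁ y' = -s y` that vanishes at one endpoint attains its
maximal modulus at the other one, and decays as `s → ∞` in the interior. -/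
lemma exists_forall_decay (b₀ : ℝ → ℝ) (b₁ : ℝ → ℂ) [hw : IsWeight b₀] [hb : IsDrift b₀ b₁] :
    ∃ S : ℝ, 0 < S ∧ ∀ s, S ≤ s → ∀ y y' : ℝ → ℂ, IsSolution b₀ b₁ (-s) y y' →
      (y 1 = 0 → (∀ x ∈ Icc (0 : ℝ) 1, ‖y x‖ ^ 2 ≤ ‖y 0‖ ^ 2) ∧ ∀ x ∈ Ioo (0 : ℝ) 1,
        s * ‖y x‖ ^ 2 * ((prim (weight b₀) x - prim (weight b₀) (x / 2)) * (x / 2)) ≤ ‖y 0‖ ^ 2) ∧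
      (y 0 = 0 → (∀ x ∈ Icc (0 : ℝ) 1, ‖y x‖ ^ 2 ≤ ‖y 1‖ ^ 2) ∧ ∀ x ∈ Ioo (0 : ℝ) 1,
        s * ‖y x‖ ^ 2 * ((prim (weight b₀) ((x + 1) / 2) - prim (weight b₀) x) *
          ((1 - x) / 2)) ≤ ‖y 1‖ ^ 2) := by
  obtain ⟨S, hS0, hS⟩ := exists_forall_energy_le b₀ b₁
  refine ⟨S, hS0, fun s hs y y' h => ?_⟩
  have hs0 : 0 ≤ s := hS0.le.trans hs
  have hmono := monotone_prim_energy (b₀ := b₀) h.hasACDeriv hs0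
  have hac := h.hasACDeriv
  constructor
  · intro hy
    have hre := fun x hx => (hS s hs y y' h x hx).1 hy
    have hanti : ∀ a b, 0 ≤ a → a ≤ b → b ≤ 1 → ‖y b‖ ^ 2 ≤ ‖y a‖ ^ 2 := by
      intro a b ha hab hb
      rcases hab.eq_or_lt with rfl | hab
      · exact le_rfl
      obtain ⟨t, ht, he⟩ := hac.exists_normSq_sub_eq ha hab hb
      have h1 := hre t ⟨ha.trans ht.1.le, ht.2.le.trans hb⟩
      have h2 := hmono (ht.2.le.trans hb)
      nlinarith
    refine ⟨fun x hx => hanti 0 x le_rfl hx.1 hx.2, fun x hx => ?_⟩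
    have hx2 : x / 2 < x := by linarith [hx.1]
    obtain ⟨t, ht, he⟩ := hac.exists_normSq_sub_eq (a := 0) (b := x / 2) le_rfl
      (by linarith [hx.1]) (by linarith [hx.2])
    have h1 := hre t ⟨ht.1.le, by linarith [ht.2, hx.2]⟩
    have h2 := mul_prim_weight_sub_le (b₀ := b₀) hac hs0 (a := x / 2) (b := x)
      hx2.le (sq_nonneg ‖y x‖) fun r hr =>
      hanti r x (by linarith [hx.1, hr.1]) hr.2 hx.2.le
    have h3 := hmono hx.2.le
    have h4 := hmono ht.2.le
    have h5 : 2 * (y' t * star (y t)).re ≤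
        -(s * ‖y x‖ ^ 2 * (prim (weight b₀) x - prim (weight b₀) (x / 2))) := by linarith
    have h6 := mul_le_mul_of_nonneg_right h5 (by linarith [hx.1] : 0 ≤ x / 2)
    have h7 : 0 ≤ ‖y (x / 2)‖ ^ 2 := sq_nonneg _
    rw [sub_zero] at he
    linarith
  · intro hy
    have hre := fun x hx => (hS s hs y y' h x hx).2 hy
    have h0 : ∀ t, 0 ≤ t → 0 ≤ prim (energy b₀ s y y') t := fun t ht => by simpa using hmono ht
    have hmon : ∀ a b, 0 ≤ a → a ≤ b → b ≤ 1 → ‖y a‖ ^ 2 ≤ ‖y b‖ ^ 2 := by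
      intro a b ha hab hb
      rcases hab.eq_or_lt with rfl | hab
      · exact le_rfl
      obtain ⟨t, ht, he⟩ := hac.exists_normSq_sub_eq ha hab hb
      have h1 := hre t ⟨ha.trans ht.1.le, ht.2.le.trans hb⟩
      have h2 := h0 t (ha.trans ht.1.le)
      nlinarith
    refine ⟨fun x hx => hmon x 1 hx.1 hx.2 le_rfl, fun x hx => ?_⟩
    have hx2 : x < (x + 1) / 2 := by linarith [hx.2]
    obtain ⟨t, ht, he⟩ := hac.exists_normSq_sub_eq (a := (x + 1) / 2) (b := 1)
      (by linarith [hx.1]) (by linarith [hx.2]) le_rfl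
    have h1 := hre t ⟨by linarith [ht.1, hx.1], ht.2.le⟩
    have h2 := mul_prim_weight_sub_le (b₀ := b₀) hac hs0 (a := x) (b := (x + 1) / 2)
      hx2.le (sq_nonneg ‖y x‖) fun r hr =>
      hmon x r hx.1.le hr.1 (by linarith [hr.2, hx.2])
    have h3 := h0 x hx.1.le
    have h4 := hmono ht.1.le
    have h5 : s * ‖y x‖ ^ 2 * (prim (weight b₀) ((x + 1) / 2) - prim (weight b₀) x) ≤
        2 * (y' t * star (y t)).re := by linarith
    have h6 := mul_le_mul_of_nonneg_right h5 (by linarith [hx.2] : 0 ≤ (1 - x) / 2)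
    have h7 : 0 ≤ ‖y ((x + 1) / 2)‖ ^ 2 := sq_nonneg _
    have h8 : (1 - (x + 1) / 2 : ℝ) = (1 - x) / 2 := by ring
    rw [h8] at he
    linarith

end Decay

section Nonvanishing

lemma tendsto_integral_zero_of_decay (ν : Measure (Ioo (0 : ℝ) 1)) [IsFiniteMeasure ν]
    (F : ℕ → ℝ →ᵇ ℂ) (q : ℝ → ℝ) (hq : ∀ x ∈ Ioo (0 : ℝ) 1, 0 < q x)
    (h1 : ∀ᶠ n in atTop, ∀ x ∈ Icc (0 : ℝ) 1, ‖F n x‖ ^ 2 ≤ 1)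
    (h2 : ∀ᶠ n : ℕ in atTop, ∀ x ∈ Ioo (0 : ℝ) 1, n * ‖F n x‖ ^ 2 * q x ≤ 1) :
    Tendsto (fun n => ∫ t, F n t ∂ν) atTop (𝓝 0) := by
  rw [← integral_zero (Ioo (0 : ℝ) 1) ℂ (μ := ν)]
  refine tendsto_integral_filter_of_dominated_convergence (fun _ => 1)
    (Eventually.of_forall fun n =>
      ((F n).continuous.comp continuous_subtype_val).aestronglyMeasurable) ?_ (integrable_const _)
      (ae_of_all _ fun x => ?_)
  · filter_upwards [h1] with n hn
    refine ae_of_all _ fun x => ?_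
    exact (sq_le_one_iff₀ (norm_nonneg _)).1 (hn x (Ioo_subset_Icc_self x.2))
  · have hlim : Tendsto (fun n : ℕ => (q x)⁻¹ / (n : ℝ)) atTop (𝓝 0) :=
      tendsto_const_div_atTop_nhds_zero_nat _
    have hsq : Tendsto (fun n => ‖F n x‖ ^ 2) atTop (𝓝 0) := by
      refine squeeze_zero' (Eventually.of_forall fun n => sq_nonneg _) ?_ hlim
      filter_upwards [h2, eventually_gt_atTop 0] with n hn hn0
      have hn0' : (0 : ℝ) < n := by exact_mod_cast hn0
      have hqx := hq x x.2
      rw [← one_div, div_div, le_div_iff₀ (by positivity)]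
      linarith [hn x x.2]
    have := hsq.sqrt
    simp only [Real.sqrt_sq (norm_nonneg _), Real.sqrt_zero] at this
    exact tendsto_zero_iff_norm_tendsto_zero.2 this

variable (b₀ : ℝ → ℝ) (b₁ : ℝ → ℂ) [hb : IsDrift b₀ b₁] [hw : IsWeight b₀]
  (ν₀ ν₁ : Measure (Ioo (0 : ℝ) 1)) [IsFiniteMeasure ν₀] [IsFiniteMeasure ν₁]

/-- The resolvent set is not empty: for `z = -n` and `n → ∞` the boundary values of the two
solutions that are one at one endpoint and zero at the other one tend to the identity matrix. -/
lemma nonempty_resolventSet :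
    (UnboundedOp.resolventSet (jumpOperator b₀ b₁ ν₀ ν₁)).Nonempty := by
  obtain ⟨S, hS0, hS⟩ := exists_forall_decay b₀ b₁
  let z : ℕ → ℂ := fun n => -((n : ℝ) : ℂ)
  let d : ℕ → ℂ := fun n => eigenSol b₀ b₁ (z n) 0 1 1
  have hev : ∀ᶠ n : ℕ in atTop, S ≤ (n : ℝ) := tendsto_natCast_atTop_atTop.eventually_ge_atTop S
  have hd : ∀ᶠ n in atTop, d n ≠ 0 := by
    filter_upwards [hev] with n hn h0
    have hsol : IsSolution b₀ b₁ (z n) (eigenSol b₀ b₁ (z n) 0 1) _ := isSolution_eigenSol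
    have h1 := ((hS n hn _ _ hsol).1 h0).1
    rw [eigenSol_apply_zero] at h1
    have h2 : ∀ x ∈ Icc (0 : ℝ) 1, eigenSol b₀ b₁ (z n) 0 1 x = 0 := fun x hx => by
      have := h1 x hx
      rw [norm_zero, zero_pow two_ne_zero] at this
      exact norm_eq_zero.1 (pow_eq_zero_iff two_ne_zero |>.1 (le_antisymm this (sq_nonneg _)))
    have h3 := hsol.hasACDeriv.hasDeriv 0 (by simp)
    rw [solDeriv_zero] at h3
    have h4 : HasDerivWithinAt (eigenSol b₀ b₁ (z n) 0 1) (0 : ℂ) (Icc 0 1) 0 :=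
      (hasDerivWithinAt_const 0 (Icc (0 : ℝ) 1) (0 : ℂ)).congr h2 (h2 0 (by simp))
    exact one_ne_zero ((uniqueDiffOn_Icc zero_lt_one 0 (by simp)).eq_deriv _ h3 h4)
  let p₀ : ℕ → ℝ →ᵇ ℂ := fun n => eigenSol b₀ b₁ (z n) 1 (-eigenSol b₀ b₁ (z n) 1 0 1 / d n)
  let p₁ : ℕ → ℝ →ᵇ ℂ := fun n => eigenSol b₀ b₁ (z n) 0 (d n)⁻¹
  have e₀ : ∀ n, p₀ n = eigenSol b₀ b₁ (z n) 1 0 +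
      (-eigenSol b₀ b₁ (z n) 1 0 1 / d n) • eigenSol b₀ b₁ (z n) 0 1 := fun n => by
    simp only [p₀]
    rw [eigenSol_eq_add, one_smul]
  have e₁ : ∀ n, p₁ n = (d n)⁻¹ • eigenSol b₀ b₁ (z n) 0 1 := fun n => by
    simp only [p₁]
    rw [eigenSol_eq_add, zero_smul, zero_add]
  have hp₀ : ∀ n, p₀ n 0 = 1 := fun n => eigenSol_apply_zero
  have hp₁ : ∀ n, p₁ n 0 = 0 := fun n => eigenSol_apply_zero
  have hp₀' : ∀ᶠ n in atTop, p₀ n 1 = 0 := by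
    filter_upwards [hd] with n hn
    rw [e₀, BoundedContinuousFunction.add_apply, BoundedContinuousFunction.smul_apply, smul_eq_mul]
    change _ + _ * d n = 0
    field_simp
    ring
  have hp₁' : ∀ᶠ n in atTop, p₁ n 1 = 1 := by
    filter_upwards [hd] with n hn
    rw [e₁, BoundedContinuousFunction.smul_apply, smul_eq_mul]
    exact inv_mul_cancel₀ hn
  have lim₀ : ∀ (ν : Measure (Ioo (0 : ℝ) 1)) [IsFiniteMeasure ν],
      Tendsto (fun n => ∫ t, p₀ n t ∂ν) atTop (𝓝 0) := by
    intro ν _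
    refine tendsto_integral_zero_of_decay ν p₀ _ (fun x hx => mul_pos (sub_pos.2 (prim_weight_lt b₀
      (by linarith [hx.1]) (by linarith [hx.1] : x / 2 < x) hx.2.le))
      (by linarith [hx.1] : 0 < x / 2)) ?_ ?_
    · filter_upwards [hev, hp₀'] with n hn h1
      have := ((hS n hn (p₀ n) _ isSolution_eigenSol).1 h1).1
      rwa [hp₀, norm_one, one_pow] at this
    · filter_upwards [hev, hp₀'] with n hn h1
      have := ((hS n hn (p₀ n) _ isSolution_eigenSol).1 h1).2
      rwa [hp₀, norm_one, one_pow] at this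
  have lim₁ : ∀ (ν : Measure (Ioo (0 : ℝ) 1)) [IsFiniteMeasure ν],
      Tendsto (fun n => ∫ t, p₁ n t ∂ν) atTop (𝓝 0) := by
    intro ν _
    refine tendsto_integral_zero_of_decay ν p₁ _ (fun x hx => mul_pos (sub_pos.2 (prim_weight_lt b₀
      hx.1.le (by linarith [hx.2] : x < (x + 1) / 2) (by linarith [hx.2])))
      (by linarith [hx.2] : 0 < (1 - x) / 2)) ?_ ?_
    · filter_upwards [hev, hp₁'] with n hn h1
      have := ((hS n hn _ _ isSolution_eigenSol).2 (hp₁ n)).1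
      rwa [h1, norm_one, one_pow] at this
    · filter_upwards [hev, hp₁'] with n hn h1
      have := ((hS n hn _ _ isSolution_eigenSol).2 (hp₁ n)).2
      rwa [h1, norm_one, one_pow] at this
  have hdet : Tendsto (fun n => (1 - ∫ t, p₀ n t ∂ν₀) * (1 - ∫ t, p₁ n t ∂ν₁) -
      (∫ t, p₁ n t ∂ν₀) * ∫ t, p₀ n t ∂ν₁) atTop (𝓝 1) := by
    have := (((lim₀ ν₀).const_sub 1).mul ((lim₁ ν₁).const_sub 1)).sub ((lim₁ ν₀).mul (lim₀ ν₁))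
    simpa using this
  obtain ⟨n, hn, hdn, h0, h1⟩ := ((hdet.eventually_ne one_ne_zero).and
    (hd.and (hp₀'.and hp₁'))).exists
  refine ⟨z n, (isBoundaryProblem b₀ b₁ ν₀ ν₁).mem_resolventSet_iff.2 fun hc => hn ?_⟩
  have b00 : boundaryFun 0 ν₀ (p₀ n) = 1 - ∫ t, p₀ n t ∂ν₀ := by rw [boundaryFun_apply, hp₀]
  have b10 : boundaryFun 1 ν₁ (p₀ n) = -∫ t, p₀ n t ∂ν₁ := by
    rw [boundaryFun_apply, h0, zero_sub]
  have b01 : boundaryFun 0 ν₀ (p₁ n) = -∫ t, p₁ n t ∂ν₀ := by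
    rw [boundaryFun_apply, hp₁, zero_sub]
  have b11 : boundaryFun 1 ν₁ (p₁ n) = 1 - ∫ t, p₁ n t ∂ν₁ := by rw [boundaryFun_apply, h1]
  have hc' : boundaryFun 0 ν₀ (eigenSol b₀ b₁ (z n) 1 0) *
      boundaryFun 1 ν₁ (eigenSol b₀ b₁ (z n) 0 1) - boundaryFun 0 ν₀ (eigenSol b₀ b₁ (z n) 0 1) *
      boundaryFun 1 ν₁ (eigenSol b₀ b₁ (z n) 1 0) = 0 := by
    simpa [UnboundedOp.charFun, eigenSol] using hc
  rw [← b00, ← b11, ← neg_neg (∫ t, p₁ n t ∂ν₀), ← neg_neg (∫ t, p₀ n t ∂ν₁), ← b01, ← b10, e₀, e₁]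
  simp only [map_add, map_smul, smul_eq_mul]
  linear_combination (d n)⁻¹ * hc'

end Nonvanishing

end JumpDiffusion

/-! ### The resolvent formula -/

namespace JumpDiffusion

open BoundedContinuousFunction

section ResolventFormula

variable {b₀ : ℝ → ℝ} {b₁ : ℝ → ℂ} [hb : IsDrift b₀ b₁] [hw : IsWeight b₀]

lemma isContRep_toL2w (y : ℝ →ᵇ ℂ) : IsContRep (toL2w b₀ y) y :=
  ⟨y.continuous.continuousOn, coeFn_toL2w b₀ y⟩

/-- Krein's formula: adding to a solution with zero boundary values the combination of the
fundamental solutions that Cramer's rule prescribes gives a solution of the nonlocal boundary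
conditions. -/
lemma resolvent_formula {ν₀ ν₁ : Measure (Ioo (0 : ℝ) 1)} [IsFiniteMeasure ν₀] [IsFiniteMeasure ν₁]
    {z : ℂ} (h0 : z ∈ UnboundedOp.resolventSet (dirichletOperator b₀ b₁))
    (h1 : z ∈ UnboundedOp.resolventSet (jumpOperator b₀ b₁ ν₀ ν₁))
    (hΔ : charDet ν₀ ν₁ (eigenSol b₀ b₁ z 1 0) (eigenSol b₀ b₁ z 0 1) ≠ 0) (f : L2w b₀) :
    ∃ u v : ℝ → ℂ, IsContRep (UnboundedOp.resolvent (dirichletOperator b₀ b₁) z f) u ∧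
      IsContRep (UnboundedOp.resolvent (jumpOperator b₀ b₁ ν₀ ν₁) z f) v ∧
      ∀ x, v x = u x +
        g₀ ν₀ ν₁ (eigenSol b₀ b₁ z 1 0) (eigenSol b₀ b₁ z 0 1) x * (∫ t, u t ∂ν₀) +
        g₁ ν₀ ν₁ (eigenSol b₀ b₁ z 1 0) (eigenSol b₀ b₁ z 0 1) x * (∫ t, u t ∂ν₁) := by
  have hR := (UnboundedOp.isResolventAt_iff.1 (UnboundedOp.isResolventAt_resolvent h0)).1 f
  obtain ⟨c₁, c₂, u, hu, hu1, hu2, hu3⟩ :=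
    (isBoundaryProblem b₀ b₁ 0 0).mem_graph_add_smul.1 hR
  simp only [boundaryFun_eq_zero_iff, integral_zero_measure] at hu2 hu3
  set y₁ := eigenSol b₀ b₁ z 1 0 with hy₁
  set y₂ := eigenSol b₀ b₁ z 0 1 with hy₂
  set Δ := charDet ν₀ ν₁ y₁ y₂ with hΔd
  have hΔe : Δ = boundaryFun 0 ν₀ y₁ * boundaryFun 1 ν₁ y₂ -
      boundaryFun 0 ν₀ y₂ * boundaryFun 1 ν₁ y₁ := by
    rw [hΔd, charDet, Matrix.det_fin_two_of]
    simp only [boundaryFun_apply, hy₁, hy₂, eigenSol_apply_zero]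
    ring
  have hB0 : boundaryFun 0 ν₀ u = -∫ t, u t ∂ν₀ := by rw [boundaryFun_apply, hu2, zero_sub]
  have hB1 : boundaryFun 1 ν₁ u = -∫ t, u t ∂ν₁ := by rw [boundaryFun_apply, hu3, zero_sub]
  let a₁ : ℂ := (boundaryFun 1 ν₁ y₂ * (∫ t, u t ∂ν₀) - boundaryFun 0 ν₀ y₂ * ∫ t, u t ∂ν₁) / Δ
  let a₂ : ℂ := (boundaryFun 0 ν₀ y₁ * (∫ t, u t ∂ν₁) - boundaryFun 1 ν₁ y₁ * ∫ t, u t ∂ν₀) / Δ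
  have hv : UnboundedOp.resolvent (jumpOperator b₀ b₁ ν₀ ν₁) z f =
      toL2w b₀ (u + a₁ • y₁ + a₂ • y₂) := by
    refine (UnboundedOp.isResolventAt_resolvent h1).apply_eq ?_
    refine (isBoundaryProblem b₀ b₁ ν₀ ν₁).mem_graph_add_smul.2
      ⟨c₁ + a₁, c₂ + a₂, u + a₁ • y₁ + a₂ • y₂, ?_, rfl, ?_, ?_⟩
    · rw [hu, hy₁, hy₂]
      simp only [eigenSol, map_add, map_smul, one_smul, zero_smul, add_zero, zero_add]
      module
    · simp only [map_add, map_smul, smul_eq_mul, hB0, a₁, a₂]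
      field_simp
      rw [hΔe]
      ring
    · simp only [map_add, map_smul, smul_eq_mul, hB1, a₁, a₂]
      field_simp
      rw [hΔe]
      ring
  refine ⟨u, (u + a₁ • y₁ + a₂ • y₂ : ℝ →ᵇ ℂ), ?_, ?_, fun x => ?_⟩
  · rw [← hu1]
    exact isContRep_toL2w u
  · rw [hv]
    exact isContRep_toL2w _
  · have hz : y₁ 0 = 1 := eigenSol_apply_zero
    have hz' : y₂ 0 = 0 := eigenSol_apply_zero
    simp only [BoundedContinuousFunction.add_apply, BoundedContinuousFunction.smul_apply,
      smul_eq_mul, a₁, a₂, g₀, g₁, boundaryFun_apply, hz, hz', ← hΔd]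
    ring

end ResolventFormula

end JumpDiffusion

end

theorem proposition2 (b₀ : ℝ → ℝ) (b₁ : ℝ → ℂ)
    (hneg : ∀ᵐ x ∂volume.restrict (Ioo (0 : ℝ) 1), b₀ x < 0)
    (hw : IntegrableOn (fun x => -1 / b₀ x) (Ioo 0 1))
    (hb₁ : IntegrableOn (fun x => b₁ x / (b₀ x : ℂ)) (Ioo 0 1))
    (ν₀ ν₁ : Measure (Ioo (0 : ℝ) 1)) [IsProbabilityMeasure ν₀] [IsProbabilityMeasure ν₁] :
    -- `L` is closed and has purely discrete spectrum
    (JumpDiffusion.jumpOperator b₀ b₁ ν₀ ν₁).IsClosed ∧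
    UnboundedOp.HasPurelyDiscreteSpectrum (JumpDiffusion.jumpOperator b₀ b₁ ν₀ ν₁) ∧
    -- the resolvent of `L` is compact
    (∀ z ∈ UnboundedOp.resolventSet (JumpDiffusion.jumpOperator b₀ b₁ ν₀ ν₁),
      IsCompactOperator (UnboundedOp.resolvent (JumpDiffusion.jumpOperator b₀ b₁ ν₀ ν₁) z)) ∧
    -- the resolvent formula
    (∀ z ∈ UnboundedOp.resolventSet (JumpDiffusion.dirichletOperator b₀ b₁),
      z ∉ UnboundedOp.pointSpectrum (JumpDiffusion.jumpOperator b₀ b₁ ν₀ ν₁) →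
      z ∈ UnboundedOp.resolventSet (JumpDiffusion.jumpOperator b₀ b₁ ν₀ ν₁) ∧
      ∃ y₁ y₂ : ℝ → ℂ, JumpDiffusion.IsFundamentalPair b₀ b₁ z y₁ y₂ ∧
        JumpDiffusion.charDet ν₀ ν₁ y₁ y₂ ≠ 0 ∧
        ∀ f : JumpDiffusion.L2w b₀, ∃ u v : ℝ → ℂ,
          JumpDiffusion.IsContRep
            (UnboundedOp.resolvent (JumpDiffusion.dirichletOperator b₀ b₁) z f) u ∧
          JumpDiffusion.IsContRep
            (UnboundedOp.resolvent (JumpDiffusion.jumpOperator b₀ b₁ ν₀ ν₁) z f) v ∧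
          ∀ x ∈ Icc (0 : ℝ) 1, v x = u x +
            JumpDiffusion.g₀ ν₀ ν₁ y₁ y₂ x * (∫ t, u t ∂ν₀) +
            JumpDiffusion.g₁ ν₀ ν₁ y₁ y₂ x * (∫ t, u t ∂ν₁)) ∧
    -- every point of the spectrum is a pole of the resolvent, and the ascent is finite
    ∀ z₀ ∈ UnboundedOp.spectrum (JumpDiffusion.jumpOperator b₀ b₁ ν₀ ν₁),
      UnboundedOp.IsResolventPole (JumpDiffusion.jumpOperator b₀ b₁ ν₀ ν₁) z₀ ∧
      UnboundedOp.ascent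
        (UnboundedOp.shift (JumpDiffusion.jumpOperator b₀ b₁ ν₀ ν₁) z₀) ≠ ⊤ := by
  have : JumpDiffusion.IsWeight b₀ := ⟨hneg, hw⟩
  have : JumpDiffusion.IsDrift b₀ b₁ := ⟨hb₁⟩
  have h := JumpDiffusion.isBoundaryProblem b₀ b₁ ν₀ ν₁
  have hne := JumpDiffusion.nonempty_resolventSet b₀ b₁ ν₀ ν₁
  refine ⟨UnboundedOp.isClosed_of_mem_resolventSet hne.choose_spec,
    h.hasPurelyDiscreteSpectrum hne, fun z hz => h.isCompactOperator_resolvent hz,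
    fun z hz0 hz => ?_, fun z₀ hz₀ => ⟨h.isResolventPole hne hz₀, h.ascent_shift_ne_top hne z₀⟩⟩
  have hz1 := h.mem_resolventSet_of_notMem_pointSpectrum hz
  have hΔ : JumpDiffusion.charDet ν₀ ν₁ (JumpDiffusion.eigenSol b₀ b₁ z 1 0)
      (JumpDiffusion.eigenSol b₀ b₁ z 0 1) ≠ 0 := by
    rw [← JumpDiffusion.charFun_eq_charDet]
    exact h.mem_resolventSet_iff.1 hz1
  refine ⟨hz1, _, _, JumpDiffusion.isFundamentalPair_eigenSol, hΔ, fun f => ?_⟩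
  obtain ⟨u, v, hu, hv, huv⟩ := JumpDiffusion.resolvent_formula hz0 hz1 hΔ f
  exact ⟨u, v, hu, hv, fun x _ => huv x⟩
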